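/- Let $(\Omega,\mathcal F,\mathbb P)$ be a probability space and $d\ge 0$ an integer. Let $I_n:\{1,\dots,n\}^2\to\mathbb Z^d$, $n\ge 1$, be functions (a link family), and let $\{Z_z\}_{z\in\mathbb Z^d}$ be independent complex random variables. Let $X_n$ be random Hermitian $n\times n$ matrices with $(X_n)_{ij}=\overline{(X_n)_{ji}}=Z_{I_n(i,j)}$ for $i\le j$. For a Hermitian $n\times n$ matrix $A$ with eigenvalues $\lambda_1,\dots,\lambda_n$ put $L_n^A=\frac1n\sum_{i=1}^n\delta_{\lambda_i}$; for a random Hermitian $A$ let $\mathbb E L_n^A$ be the probability measure with $(\mathbb E L_n^A)(B)=\mathbb E\big(L_n^A(B)\big)$ for every Borel set $B\subset\mathbb R$. (1) Assume that $(X_n)$ satisfies condition $\mathcal L$, i.e. for every $\varepsilon>0$ $$\lim_{M\to\infty}\limsup_{n\to\infty}\mathbb P\Big(\frac1{n^2}\sum_{i,j=1}^n|(X_n)_{ij}|^2\mathbf 1_{\{|(X_n)_{ij}|>M\}}>\varepsilon\Big)=0,$$ and that $|I_n^{-1}(z)|=o(n^2)$ uniformly in $z$, i.e. $\sup_{z\in\mathbb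 Z^d}|I_n^{-1}(z)|/n^2\to0$ as $n\to\infty$. Then for every metric $\rho$ that metrizes weak convergence of probability measures on $\mathbb R$, $$\rho\big(L_n^{X_n/\sqrt n},\,\mathbb E L_n^{X_n/\sqrt n}\big)\to0\quad\text{in probability.}$$ (2) The link families $I_n(i,j)=(\min(i,j),\max(i,j))$ (Wigner), $|i-j|$ (Toeplitz), $i+j$ (Hankel), $i+j \bmod n$ (reversed circulant) and $\frac n2-\big|\frac n2-|i-j|\big|$ (symmetric circulant) satisfy $\sup_z|I_n^{-1}(z)|=o(n^2)$; and if the family $\{|Z_z|^2\}_z$ is uniformly integrable (for instance, if the $Z_z$ are identically distributed with finite second moment), then matrices $X_n$ associated with one of these link families satisfy condition $\mathcal L$. Hence (1) applies to these ensembles. -/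

import Mathlib

open MeasureTheory ProbabilityTheory Filter Topology
open scoped ENNReal

/-- The real vector space of `n × n` complex Hermitian matrices. -/
abbrev HermMat (n : ℕ) : Type := selfAdjoint (Matrix (Fin n) (Fin n) ℂ)

/-- The empirical spectral distribution `(1/n) ∑ᵢ δ_{λᵢ}` as a measure, where the `λᵢ` are the
eigenvalues of the Hermitian matrix `A`, counted with multiplicity. -/
noncomputable def esdMeasure {n : ℕ} (A : HermMat n) : Measure ℝ :=
  (n : ℝ≥0∞)⁻¹ •
    ∑ i, Measure.dirac (Matrix.IsHermitian.eigenvalues (A := (A : Matrix (Fin n) (Fin n) ℂ)) A.2 i)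

theorem isProbabilityMeasure_esdMeasure {n : ℕ} (hn : n ≠ 0) (A : HermMat n) :
    IsProbabilityMeasure (esdMeasure A) := by
  constructor
  simp [esdMeasure]
  exact ENNReal.inv_mul_cancel (by exact_mod_cast hn) (ENNReal.natCast_ne_top n)

/-- The empirical spectral distribution as a probability measure. The (irrelevant) empty matrix is
given the value `δ₀`. -/
noncomputable def esd {n : ℕ} (A : HermMat n) : ProbabilityMeasure ℝ :=
  if hn : n = 0 then ⟨Measure.dirac 0, inferInstance⟩
  else ⟨esdMeasure A, isProbabilityMeasure_esdMeasure hn A⟩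

/-- `ν` is the expectation of the random probability measure `L`: `ν(s) = 𝔼 (L(s))` for every Borel
set `s`. This determines `ν`. -/
def IsMeanMeasure {Ω : Type*} [MeasurableSpace Ω] (P : Measure Ω)
    (L : Ω → ProbabilityMeasure ℝ) (ν : ProbabilityMeasure ℝ) : Prop :=
  ∀ s : Set ℝ, MeasurableSet s → (ν : Measure ℝ) s = ∫⁻ ω, (L ω : Measure ℝ) s ∂P

/-- The random probability measures `L n` have expectations `EL n`, and `d (L n) (EL n) → 0` in
probability for every metric `d` that metrizes weak convergence of probability measures on `ℝ`. -/
def ConcentratesAroundMean {Ω : Type*} [MeasurableSpace Ω] (P : Measure Ω)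
    (L : ℕ → Ω → ProbabilityMeasure ℝ) : Prop :=
  ∃ EL : ℕ → ProbabilityMeasure ℝ, (∀ n, IsMeanMeasure P (L n) (EL n)) ∧
    ∀ d : MetricSpace (ProbabilityMeasure ℝ),
      d.toPseudoMetricSpace.toUniformSpace.toTopologicalSpace =
        ProbabilityMeasure.instTopologicalSpace →
      TendstoInMeasure P (fun n ω => d.dist (L n ω) (EL n)) atTop (fun _ => (0 : ℝ))

open scoped Classical in
/-- The Lindeberg-type condition: for every `ε > 0`,
`lim_{M → ∞} limsup_{n → ∞} P (n⁻² ∑_{i,j} |X_n(i,j)|² 1{|X_n(i,j)| > M} > ε) = 0`. -/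
def LindebergCondition {Ω : Type*} [MeasurableSpace Ω] (P : Measure Ω)
    (X : (n : ℕ) → Ω → HermMat n) : Prop :=
  ∀ ε : ℝ, 0 < ε →
    Tendsto (fun M : ℝ =>
        limsup (fun n : ℕ => P {ω | ε < 1 / (n : ℝ) ^ 2 *
          ∑ i, ∑ j, if M < ‖(X n ω).1 i j‖ then ‖(X n ω).1 i j‖ ^ 2 else 0}) atTop)
      atTop (𝓝 0)

/-- A link family: functions `I n` from `{1, …, n}²` to `ℤ^d`. The element `i : Fin n` stands for
the index `i + 1`. -/
abbrev LinkFamily (d : ℕ) : Type := (n : ℕ) → Fin n → Fin n → (Fin d → ℤ)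

/-- The fibre `I_n⁻¹(z)` in `{1, …, n}²`. -/
def LinkFamily.fiber {d : ℕ} (I : LinkFamily d) (n : ℕ) (z : Fin d → ℤ) :
    Finset (Fin n × Fin n) :=
  Finset.univ.filter fun p => I n p.1 p.2 = z

/-- `|I_n⁻¹(z)| = o(n²)`, uniformly in `z`. -/
def LinkFamily.SmallFibers {d : ℕ} (I : LinkFamily d) : Prop :=
  ∀ ε : ℝ, 0 < ε → ∀ᶠ n : ℕ in atTop, ∀ z : Fin d → ℤ,
    ((I.fiber n z).card : ℝ) ≤ ε * (n : ℝ) ^ 2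

/-- The Hermitian random matrices `X n` are associated with the link family `I` and the variables
`Z`: the entry at `(i, j)` is `Z_{I_n(i,j)}` for `i ≤ j` (and, by Hermitian symmetry, the entry at
`(j, i)` is its conjugate). -/
def IsPatterned {Ω : Type*} {d : ℕ} (I : LinkFamily d) (Z : (Fin d → ℤ) → Ω → ℂ)
    (X : (n : ℕ) → Ω → HermMat n) : Prop :=
  ∀ (n : ℕ) (ω : Ω) (i j : Fin n), i ≤ j → (X n ω).1 i j = Z (I n i j) ω

/-- `(min(i,j), max(i,j))` -/
def wignerLink : LinkFamily 2 :=
  fun _ i j => ![((min i j : Fin _) : ℤ) + 1, ((max i j : Fin _) : ℤ) + 1]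

/-- `|i - j|` -/
def toeplitzLink : LinkFamily 1 := fun _ i j => ![|(i : ℤ) - (j : ℤ)|]

/-- `i + j` -/
def hankelLink : LinkFamily 1 := fun _ i j => ![((i : ℤ) + 1) + ((j : ℤ) + 1)]

/-- `i + j mod n` -/
def reversedCirculantLink : LinkFamily 1 :=
  fun n i j => ![(((i : ℤ) + 1) + ((j : ℤ) + 1)) % (n : ℤ)]

/-- `n/2 - |n/2 - |i - j|| = min(|i - j|, n - |i - j|)` -/
def symmetricCirculantLink : LinkFamily 1 :=
  fun n i j => ![min |(i : ℤ) - (j : ℤ)| ((n : ℤ) - |(i : ℤ) - (j : ℤ)|)]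

/-- The link families of the Wigner, Toeplitz, Hankel, reversed circulant and symmetric circulant
ensembles. -/
inductive IsClassicalLink : {d : ℕ} → LinkFamily d → Prop
  | wigner : IsClassicalLink wignerLink
  | toeplitz : IsClassicalLink toeplitzLink
  | hankel : IsClassicalLink hankelLink
  | reversedCirculant : IsClassicalLink reversedCirculantLink
  | symmetricCirculant : IsClassicalLink symmetricCirculantLink

/-! Spectral measures are tested against powers of the Cayley transform c(x) = (x+i)/(x-i). For
Hermitian A the matrix U = c(A) is unitary and equals 1 + 2i(A-i)⁻¹, so the moment of c^k is tr U^k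
/ n and the resolvent identity controls its dependence on A in Frobenius norm.

The heart is a variance bound for entries truncated at M. By Efron–Stein it suffices to sum, over z,
the squared change of a moment when Z_z alone is resampled. A Lipschitz bound gives only O(1).
Instead tr U^k is expanded to second order (`exists_trace_cayleyMat_expansion`). The perturbations
D_z have disjoint supports, so the linear terms satisfy Σ|tr(G D_z)|² ≤ ‖G‖² max‖D_z‖², and the
quadratic ones satisfy Σ‖D_z‖⁴ ≤ max‖D_z‖² Σ‖D_z‖². Both contain max‖D_z‖², which is o(n²) by the
fibre condition (`sum_norm_cayleyMoment_sub_sq_le`).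

Condition L removes the truncation, through the Lipschitz bound, and also gives tightness, through
second moments. The powers of c and their conjugates span a point-separating star algebra, so on a
tight set finitely many Cayley moments control any metric for weak convergence
(`exists_dist_lt_of_cayley_close`).

For the classical links every row meets a fibre in boundedly many places. Condition L follows from
uniform integrability by Markov's inequality. -/

section CayleyTransform

open Matrix Unitary
open scoped Matrix.Norms.Frobenius

variable {m : Type*} [Fintype m] [DecidableEq m]

/-! ### Frobenius norm and traces. -/

theorem frobenius_norm_sq (A : Matrix m m ℂ) : ‖A‖ ^ 2 = ∑ i, ∑ j, ‖A i j‖ ^ 2 := by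
  rw [frobenius_norm_def, ← Real.rpow_natCast, ← Real.rpow_mul (by positivity)]
  norm_num

theorem trace_conjTranspose_mul_self (A : Matrix m m ℂ) :
    (Aᴴ * A).trace = ((‖A‖ ^ 2 : ℝ) : ℂ) := by
  rw [frobenius_norm_sq, Finset.sum_comm]
  simp only [Matrix.trace, diag_apply, mul_apply, conjTranspose_apply]
  push_cast
  refine Finset.sum_congr rfl fun i _ => Finset.sum_congr rfl fun j _ => ?_
  rw [RCLike.star_def, Complex.conj_mul']

theorem frobenius_norm_unitary_mul {U : Matrix m m ℂ} (hU : U ∈ unitary (Matrix m m ℂ))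
    (A : Matrix m m ℂ) : ‖U * A‖ = ‖A‖ := by
  have h : (((‖U * A‖ ^ 2 : ℝ)) : ℂ) = ((‖A‖ ^ 2 : ℝ) : ℂ) := by
    rw [← trace_conjTranspose_mul_self, ← trace_conjTranspose_mul_self, conjTranspose_mul,
      Matrix.mul_assoc, ← Matrix.mul_assoc Uᴴ, ← star_eq_conjTranspose U,
      (Unitary.mem_iff.1 hU).1, Matrix.one_mul]
  have h' : ‖U * A‖ ^ 2 = ‖A‖ ^ 2 := by exact_mod_cast h
  exact (pow_left_inj₀ (norm_nonneg _) (norm_nonneg _) two_ne_zero).1 h'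

theorem frobenius_norm_mul_unitary {U : Matrix m m ℂ} (hU : U ∈ unitary (Matrix m m ℂ))
    (A : Matrix m m ℂ) : ‖A * U‖ = ‖A‖ := by
  rw [← frobenius_norm_conjTranspose, conjTranspose_mul, ← star_eq_conjTranspose U,
    frobenius_norm_unitary_mul (Unitary.star_mem hU), frobenius_norm_conjTranspose]

/-- Cauchy–Schwarz over pairs of indices; the sum for `B` is reordered because the trace pairs `A i
j` with `B j i`. -/
theorem norm_trace_mul_le (A B : Matrix m m ℂ) : ‖(A * B).trace‖ ≤ ‖A‖ * ‖B‖ := by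
  refine abs_le_of_sq_le_sq' ?_ (by positivity) |>.2
  rw [mul_pow, frobenius_norm_sq, frobenius_norm_sq B, Finset.sum_comm (γ := m) (f := fun i j => ‖B i j‖ ^ 2)]
  simp only [Matrix.trace, diag_apply, mul_apply]
  rw [← Finset.sum_product', ← Finset.sum_product', ← Finset.sum_product']
  refine le_trans ?_ (Finset.sum_mul_sq_le_sq_mul_sq _ _ _)
  gcongr
  refine (norm_sum_le _ _).trans (le_of_eq ?_)
  simp

theorem frobenius_norm_one_sq : ‖(1 : Matrix m m ℂ)‖ ^ 2 = Fintype.card m := by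
  have h := trace_conjTranspose_mul_self (1 : Matrix m m ℂ)
  simp only [conjTranspose_one, Matrix.one_mul, trace_one] at h
  exact_mod_cast h.symm

theorem norm_trace_le (A : Matrix m m ℂ) : ‖A.trace‖ ≤ √(Fintype.card m) * ‖A‖ := by
  have h := norm_trace_mul_le 1 A
  rwa [Matrix.one_mul, ← Real.sqrt_sq (norm_nonneg (1 : Matrix m m ℂ)),
    frobenius_norm_one_sq] at h

/-- The matrix `f(A)` for a Hermitian matrix `A` and a complex function `f` on the real line. -/
noncomputable def specFun {A : Matrix m m ℂ} (hA : A.IsHermitian) (f : ℝ → ℂ) : Matrix m m ℂ :=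
  conjStarAlgAut ℂ _ hA.eigenvectorUnitary (diagonal fun i => f (hA.eigenvalues i))

section specFun

variable {A : Matrix m m ℂ} (hA : A.IsHermitian)

theorem specFun_mul (f g : ℝ → ℂ) : specFun hA f * specFun hA g = specFun hA (f * g) := by
  simp only [specFun, ← map_mul, diagonal_mul_diagonal, Pi.mul_apply]

theorem specFun_add (f g : ℝ → ℂ) : specFun hA f + specFun hA g = specFun hA (f + g) := by
  simp only [specFun, ← map_add, diagonal_add, Pi.add_apply]

theorem specFun_const (c : ℂ) : specFun hA (fun _ => c) = c • 1 := by
  have h : (diagonal fun _ : m => c) = c • (1 : Matrix m m ℂ) := by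
    rw [smul_one_eq_diagonal]
  rw [specFun, h, map_smul, map_one]

theorem specFun_ofReal : specFun hA (fun x => (x : ℂ)) = A :=
  hA.spectral_theorem.symm

theorem star_specFun (f : ℝ → ℂ) : star (specFun hA f) = specFun hA (star f) := by
  rw [specFun, ← map_star, star_eq_conjTranspose, diagonal_conjTranspose]
  rfl

theorem specFun_pow (f : ℝ → ℂ) (k : ℕ) : specFun hA f ^ k = specFun hA (f ^ k) := by
  simp only [specFun, ← map_pow, diagonal_pow, Pi.pow_def]

theorem trace_specFun (f : ℝ → ℂ) : (specFun hA f).trace = ∑ i, f (hA.eigenvalues i) := by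
  rw [specFun, conjStarAlgAut_apply, trace_mul_cycle, Unitary.coe_star_mul_self, Matrix.one_mul,
    trace_diagonal]

end specFun

theorem ofReal_sub_I_ne_zero (x : ℝ) : (x : ℂ) - Complex.I ≠ 0 := fun h => by
  simpa using congrArg Complex.im h

/-- The Cayley transform of the real line onto the unit circle. -/
noncomputable def cayley (x : ℝ) : ℂ := (x + Complex.I) / (x - Complex.I)

theorem norm_cayley (x : ℝ) : ‖cayley x‖ = 1 := by
  have h : (x : ℂ) + Complex.I = (starRingEnd ℂ) (x - Complex.I) := by simp
  rw [cayley, norm_div, h, RCLike.norm_conj, div_self]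
  exact norm_ne_zero_iff.2 (ofReal_sub_I_ne_zero x)

theorem star_cayley_mul_cayley (x : ℝ) : star (cayley x) * cayley x = 1 := by
  rw [RCLike.star_def, Complex.conj_mul', norm_cayley]
  simp

theorem continuous_cayley : Continuous cayley := by
  unfold cayley
  exact Continuous.div (by fun_prop) (by fun_prop) ofReal_sub_I_ne_zero

theorem cayley_injective : Function.Injective cayley := by
  intro x y h
  rw [cayley, cayley, div_eq_div_iff (ofReal_sub_I_ne_zero x) (ofReal_sub_I_ne_zero y)] at h
  have h2 : (2 * Complex.I) * ((y : ℂ) - x) = 0 := by linear_combination h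
  have h3 : (y : ℂ) - x = 0 := by
    simpa using h2
  exact_mod_cast (sub_eq_zero.1 h3).symm

/-! ### Resolvent and Cayley transform of a Hermitian matrix. -/

section resolvent

variable {A : Matrix m m ℂ} (hA : A.IsHermitian)

/-- The resolvent `(A - i)⁻¹`. -/
noncomputable def resolventI : Matrix m m ℂ := specFun hA fun x => ((x : ℂ) - Complex.I)⁻¹

theorem sub_I_eq_specFun : A - Complex.I • 1 = specFun hA fun x => (x : ℂ) - Complex.I := by
  have h := specFun_add hA (fun x => (x : ℂ)) (fun _ => -Complex.I)
  rw [specFun_ofReal, specFun_const, neg_smul, ← sub_eq_add_neg] at h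
  rw [h]
  rfl

theorem resolventI_mul_sub : resolventI hA * (A - Complex.I • 1) = 1 := by
  rw [sub_I_eq_specFun hA, resolventI, specFun_mul, ← one_smul ℂ (1 : Matrix m m ℂ),
    ← specFun_const hA]
  congr 1
  funext x
  exact inv_mul_cancel₀ (ofReal_sub_I_ne_zero x)

theorem sub_mul_resolventI : (A - Complex.I • 1) * resolventI hA = 1 :=
  mul_eq_one_comm.1 (resolventI_mul_sub hA)

/-- The Cayley transform `(A + i)(A - i)⁻¹`. -/
noncomputable def cayleyMat : Matrix m m ℂ := specFun hA cayley

theorem cayleyMat_eq : cayleyMat hA = 1 + (2 * Complex.I) • resolventI hA := by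
  have h1 : (1 : Matrix m m ℂ) = specFun hA fun _ => 1 := by rw [specFun_const, one_smul]
  have h2 : (2 * Complex.I) • resolventI hA
      = specFun hA fun x => 2 * Complex.I * ((x : ℂ) - Complex.I)⁻¹ := by
    have h := specFun_mul hA (fun _ => 2 * Complex.I) fun x => ((x : ℂ) - Complex.I)⁻¹
    rw [specFun_const, smul_mul_assoc, Matrix.one_mul] at h
    exact h
  rw [h1, h2, specFun_add, cayleyMat]
  congr 1
  funext x
  have := ofReal_sub_I_ne_zero x
  simp only [cayley, Pi.add_apply]
  field_simp
  ring

theorem cayleyMat_mem_unitary : cayleyMat hA ∈ unitary (Matrix m m ℂ) := by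
  have h : star (cayleyMat hA) * cayleyMat hA = 1 := by
    rw [cayleyMat, star_specFun, specFun_mul]
    have : star cayley * cayley = fun _ => 1 := funext star_cayley_mul_cayley
    rw [this, specFun_const, one_smul]
  exact Unitary.mem_iff.2 ⟨h, mul_eq_one_comm.1 h⟩

theorem resolventI_eq : resolventI hA = (2 * Complex.I)⁻¹ • (cayleyMat hA - 1) := by
  rw [cayleyMat_eq, add_sub_cancel_left, smul_smul, inv_mul_cancel₀ (by simp), one_smul]

/-- The resolvent is (U - 1)/(2i) with U unitary, so the triangle inequality gives the factor (1 +
1)/2. No operator norm is needed. -/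
theorem norm_resolventI_mul_le (M : Matrix m m ℂ) : ‖resolventI hA * M‖ ≤ ‖M‖ := by
  rw [resolventI_eq, smul_mul_assoc, norm_smul, Matrix.sub_mul, Matrix.one_mul]
  have h := norm_sub_le (cayleyMat hA * M) M
  rw [frobenius_norm_unitary_mul (cayleyMat_mem_unitary hA)] at h
  have : ‖(2 * Complex.I)⁻¹‖ = 1 / 2 := by simp
  rw [this]
  linarith

theorem norm_mul_resolventI_le (M : Matrix m m ℂ) : ‖M * resolventI hA‖ ≤ ‖M‖ := by
  rw [resolventI_eq, mul_smul_comm, norm_smul, Matrix.mul_sub, Matrix.mul_one]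
  have h := norm_sub_le (M * cayleyMat hA) M
  rw [frobenius_norm_mul_unitary (cayleyMat_mem_unitary hA)] at h
  have : ‖(2 * Complex.I)⁻¹‖ = 1 / 2 := by simp
  rw [this]
  linarith

end resolvent

/-! ### Perturbation of traces of powers of the Cayley transform. -/

section perturbation

variable {A B : Matrix m m ℂ} (hA : A.IsHermitian) (hB : B.IsHermitian)

theorem resolventI_sub :
    resolventI hB - resolventI hA = -(resolventI hA * (B - A) * resolventI hB) := by
  have h : B - A = (B - Complex.I • 1) - (A - Complex.I • 1) := by abel
  rw [h, Matrix.mul_sub, Matrix.sub_mul, Matrix.mul_assoc, sub_mul_resolventI,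
    resolventI_mul_sub, Matrix.mul_one, Matrix.one_mul, neg_sub]

theorem cayleyMat_sub : cayleyMat hB - cayleyMat hA
    = -((2 * Complex.I) • (resolventI hA * (B - A) * resolventI hB)) := by
  rw [cayleyMat_eq, cayleyMat_eq, add_sub_add_left_eq_sub, ← smul_sub, resolventI_sub, smul_neg]

theorem norm_cayleyMat_sub_le : ‖cayleyMat hB - cayleyMat hA‖ ≤ 2 * ‖B - A‖ := by
  rw [cayleyMat_sub, norm_neg, norm_smul]
  have h : ‖2 * Complex.I‖ = 2 := by simp
  rw [h]
  gcongr
  exact (norm_mul_resolventI_le hB _).trans (norm_resolventI_mul_le hA _)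

theorem norm_cayleyMat_pow_mul (k : ℕ) (M : Matrix m m ℂ) : ‖cayleyMat hA ^ k * M‖ = ‖M‖ :=
  frobenius_norm_unitary_mul (pow_mem (cayleyMat_mem_unitary hA) k) M

theorem norm_mul_cayleyMat_pow (k : ℕ) (M : Matrix m m ℂ) : ‖M * cayleyMat hA ^ k‖ = ‖M‖ :=
  frobenius_norm_mul_unitary (pow_mem (cayleyMat_mem_unitary hA) k) M

/-- Noncommutative telescoping. With unitary powers on both sides, each summand has the Frobenius
norm of `V - U`. -/
theorem pow_sub_pow_eq_sum {R : Type*} [Ring R] (U V : R) (k : ℕ) :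
    V ^ k - U ^ k = ∑ a ∈ Finset.range k, V ^ a * (V - U) * U ^ (k - 1 - a) := by
  induction k with
  | zero => simp
  | succ k ih =>
    rw [Finset.sum_range_succ]
    have h : ∑ a ∈ Finset.range k, V ^ a * (V - U) * U ^ (k + 1 - 1 - a)
        = (V ^ k - U ^ k) * U := by
      rw [ih, Finset.sum_mul]
      refine Finset.sum_congr rfl fun a ha => ?_
      have := Finset.mem_range.1 ha
      rw [mul_assoc _ _ U, ← pow_succ]
      congr 2
      omega
    rw [h]
    simp only [add_tsub_cancel_right, tsub_self, pow_zero, mul_one, pow_succ]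
    noncomm_ring

theorem norm_cayleyMat_pow_sub_le (k : ℕ) :
    ‖cayleyMat hB ^ k - cayleyMat hA ^ k‖ ≤ k * (2 * ‖B - A‖) := by
  rw [pow_sub_pow_eq_sum]
  refine (norm_sum_le _ _).trans ?_
  calc _ ≤ ∑ _a ∈ Finset.range k, 2 * ‖B - A‖ := Finset.sum_le_sum fun a _ => by
        rw [norm_mul_cayleyMat_pow, norm_cayleyMat_pow_mul]
        exact norm_cayleyMat_sub_le hA hB
    _ = _ := by simp

theorem norm_trace_cayleyMat_pow_sub_le (k : ℕ) :
    ‖(cayleyMat hB ^ k).trace - (cayleyMat hA ^ k).trace‖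
      ≤ √(Fintype.card m) * (k * (2 * ‖B - A‖)) := by
  rw [← trace_sub]
  refine (norm_trace_le _).trans ?_
  gcongr
  exact norm_cayleyMat_pow_sub_le hA hB k

/-- By cyclicity each telescoping term has trace tr(U^(k-1-a) V^a (V-U)). Replacing V^a by U^a makes
all k terms equal, at a cost of ‖V^a - U^a‖‖V - U‖ per term, which is quadratic in ‖B - A‖. -/
theorem norm_trace_cayleyMat_pow_sub_sub_le (k : ℕ) :
    ‖(cayleyMat hB ^ k).trace - (cayleyMat hA ^ k).trace
      - k * (cayleyMat hA ^ (k - 1) * (cayleyMat hB - cayleyMat hA)).trace‖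
      ≤ k * (k * (2 * ‖B - A‖) ^ 2) := by
  set U := cayleyMat hA with hU
  set V := cayleyMat hB with hV
  have h : (V ^ k).trace - (U ^ k).trace - k * (U ^ (k - 1) * (V - U)).trace
      = ∑ a ∈ Finset.range k, (U ^ (k - 1 - a) * (V ^ a - U ^ a) * (V - U)).trace := by
    rw [← trace_sub, pow_sub_pow_eq_sum, trace_sum]
    have hc : (k : ℂ) * (U ^ (k - 1) * (V - U)).trace
        = ∑ _a ∈ Finset.range k, (U ^ (k - 1) * (V - U)).trace := by simp
    rw [hc, ← Finset.sum_sub_distrib]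
    refine Finset.sum_congr rfl fun a ha => ?_
    have := Finset.mem_range.1 ha
    have hp : U ^ (k - 1) = U ^ (k - 1 - a) * U ^ a := by
      rw [← pow_add]
      congr 1
      omega
    rw [trace_mul_comm, ← trace_sub, hp]
    congr 1
    noncomm_ring
  rw [h]
  refine (norm_sum_le _ _).trans ?_
  calc _ ≤ ∑ _a ∈ Finset.range k, (k : ℝ) * (2 * ‖B - A‖) ^ 2 := Finset.sum_le_sum fun a ha => by
        refine (norm_trace_mul_le _ _).trans ?_
        rw [hU, norm_cayleyMat_pow_mul, sq, ← mul_assoc]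
        have hak : (a : ℝ) ≤ k := by exact_mod_cast (Finset.mem_range.1 ha).le
        gcongr
        · refine (norm_cayleyMat_pow_sub_le hA hB a).trans ?_
          gcongr
        · exact norm_cayleyMat_sub_le hA hB
    _ = _ := by simp

/-- Second order expansion of the trace of a power of the Cayley transform. -/
theorem exists_trace_cayleyMat_expansion (k : ℕ) :
    ∃ G : Matrix m m ℂ, ‖G‖ ^ 2 ≤ (2 * k) ^ 2 * Fintype.card m ∧
      ∀ {B : Matrix m m ℂ} (hB : B.IsHermitian),
        ‖(cayleyMat hB ^ k).trace - (cayleyMat hA ^ k).trace - (G * (B - A)).trace‖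
          ≤ (4 * k ^ 2 + 2 * k) * ‖B - A‖ ^ 2 := by
  set R := resolventI hA with hR
  -- The gradient: insert the first-order part -2i R(B-A)R of the change of the Cayley transform
  -- into k tr(U^(k-1) ·), then move R cyclically.
  refine ⟨-((2 * k * Complex.I) • (R * cayleyMat hA ^ (k - 1) * R)), ?_, fun {B} hB => ?_⟩
  · rw [norm_neg, norm_smul, mul_pow, ← frobenius_norm_one_sq]
    have h : ‖2 * (k : ℂ) * Complex.I‖ = 2 * k := by simp
    rw [h]
    gcongr
    refine (norm_mul_resolventI_le hA _).trans ((norm_resolventI_mul_le hA _).trans ?_)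
    rw [← Matrix.mul_one (cayleyMat hA ^ (k - 1)), norm_cayleyMat_pow_mul]
  · have hE : cayleyMat hB - cayleyMat hA = -((2 * Complex.I) • (R * (B - A) * R))
        + (2 * Complex.I) • (R * (B - A) * (R * (B - A) * resolventI hB)) := by
      -- Iterating the resolvent identity once separates the part linear in `B - A` from a quadratic
      -- remainder.
      have hRB : resolventI hB = R - R * (B - A) * resolventI hB := by
        rw [sub_eq_add_neg, ← resolventI_sub hA hB, add_sub_cancel]
      rw [cayleyMat_sub hA]
      nth_rewrite 1 [hRB]
      rw [← hR, Matrix.mul_sub, smul_sub, neg_sub, sub_eq_neg_add]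
    have h1 := norm_trace_cayleyMat_pow_sub_sub_le hA hB k
    have h2 : (k : ℂ) * (cayleyMat hA ^ (k - 1) * (cayleyMat hB - cayleyMat hA)).trace
        = (-((2 * k * Complex.I) • (R * cayleyMat hA ^ (k - 1) * R)) * (B - A)).trace
        + 2 * k * Complex.I * (cayleyMat hA ^ (k - 1)
            * (R * (B - A)) * (R * (B - A) * resolventI hB)).trace := by
      have h3 : (R * cayleyMat hA ^ (k - 1) * R * (B - A)).trace
          = (cayleyMat hA ^ (k - 1) * (R * (B - A) * R)).trace := by
        rw [Matrix.mul_assoc, Matrix.mul_assoc, trace_mul_comm, Matrix.mul_assoc]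
      rw [hE, Matrix.mul_add, trace_add, Matrix.mul_neg, trace_neg, mul_smul_comm, trace_smul,
        mul_smul_comm, trace_smul, Matrix.neg_mul, trace_neg, smul_mul_assoc, trace_smul, h3]
      simp only [smul_eq_mul, Matrix.mul_assoc]
      ring
    have h4 : ‖2 * k * Complex.I * (cayleyMat hA ^ (k - 1)
            * (R * (B - A)) * (R * (B - A) * resolventI hB)).trace‖ ≤ 2 * k * ‖B - A‖ ^ 2 := by
      have h : ‖2 * (k : ℂ) * Complex.I‖ = 2 * k := by simp
      rw [norm_mul, h, sq]
      gcongr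
      refine (norm_trace_mul_le _ _).trans ?_
      gcongr
      · rw [norm_cayleyMat_pow_mul]
        exact norm_resolventI_mul_le hA _
      · exact (norm_mul_resolventI_le hB _).trans (norm_resolventI_mul_le hA _)
    rw [h2] at h1
    set X := (cayleyMat hB ^ k).trace - (cayleyMat hA ^ k).trace
    set Y := (-((2 * k * Complex.I) • (R * cayleyMat hA ^ (k - 1) * R)) * (B - A)).trace
    set W := 2 * k * Complex.I * (cayleyMat hA ^ (k - 1)
            * (R * (B - A)) * (R * (B - A) * resolventI hB)).trace
    calc ‖X - Y‖ = ‖(X - (Y + W)) + W‖ := by congr 1; ring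
      _ ≤ _ := norm_add_le _ _
      _ ≤ k * (k * (2 * ‖B - A‖) ^ 2) + 2 * k * ‖B - A‖ ^ 2 := add_le_add h1 h4
      _ = _ := by ring

end perturbation

end CayleyTransform

/-! ### The Efron–Stein inequality on a finite product space. -/

section EfronStein

variable {ι E : Type*}

/-- Read off the second components at the indices in `s`, the first components elsewhere. -/
def selectSnd [DecidableEq ι] (s : Finset ι) (x : ι → E × E) : ι → E :=
  fun i => (if i ∈ s then Prod.snd else Prod.fst) (x i)

/-- Exchange the two components at the indices in `s`. -/
def swapOn [DecidableEq ι] (s : Finset ι) (x : ι → E × E) : ι → E × E :=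
  fun i => (if i ∈ s then Prod.swap else id) (x i)

variable [Fintype ι] [DecidableEq ι] [MeasurableSpace E] (μ : ι → Measure E)
  [∀ i, IsProbabilityMeasure (μ i)]

omit [Fintype ι] in
@[fun_prop]
theorem measurable_selectSnd (s : Finset ι) : Measurable (selectSnd (E := E) s) := by
  refine measurable_pi_lambda _ fun i => ?_
  unfold selectSnd
  split_ifs <;> fun_prop

theorem measurePreserving_selectSnd (s : Finset ι) :
    MeasurePreserving (selectSnd (E := E) s) (Measure.pi fun i => (μ i).prod (μ i))
      (Measure.pi μ) := by
  refine measurePreserving_pi (fun i => (μ i).prod (μ i)) μ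
    (f := fun i => if i ∈ s then Prod.snd else Prod.fst) fun i => ?_
  split_ifs
  · exact measurePreserving_snd
  · exact measurePreserving_fst

theorem measurePreserving_swapOn (s : Finset ι) :
    MeasurePreserving (swapOn (E := E) s) (Measure.pi fun i => (μ i).prod (μ i))
      (Measure.pi fun i => (μ i).prod (μ i)) := by
  refine measurePreserving_pi (fun i => (μ i).prod (μ i)) (fun i => (μ i).prod (μ i))
    (f := fun i => if i ∈ s then Prod.swap else id) fun i => ?_
  split_ifs
  · exact Measure.measurePreserving_swap
  · exact MeasurePreserving.id _

omit [Fintype ι] [MeasurableSpace E] in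
theorem selectSnd_swapOn (s t : Finset ι) (x : ι → E × E) :
    selectSnd t (swapOn s x) = selectSnd (symmDiff t s) x := by
  funext i
  by_cases hs : i ∈ s <;> by_cases ht : i ∈ t <;>
    simp [selectSnd, swapOn, hs, ht, Finset.mem_symmDiff]

omit [Fintype ι] [MeasurableSpace E] in
theorem selectSnd_singleton (k : ι) (x : ι → E × E) :
    selectSnd {k} x = Function.update (selectSnd ∅ x) k (selectSnd {k} x k) := by
  funext i
  rcases eq_or_ne i k with rfl | h
  · simp
  · simp [selectSnd, h]

/-- The first and second components are independent copies of each other, so the expectation of the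
product factors. -/
theorem integral_selectSnd_mul_univ (F : (ι → E) → ℝ) :
    ∫ x, F (selectSnd ∅ x) * F (selectSnd Finset.univ x)
      ∂(Measure.pi fun i => (μ i).prod (μ i)) = (∫ w, F w ∂Measure.pi μ) ^ 2 := by
  have h := measurePreserving_arrowProdEquivProdArrow E E ι μ μ
  have h2 := h.integral_comp' (fun p : (ι → E) × (ι → E) => F p.1 * F p.2)
  rw [integral_prod_mul, ← sq] at h2
  rw [← h2]
  have h0 : ∀ x : ι → E × E, selectSnd ∅ x = fun i => (x i).1 := fun x => by
    funext i; simp [selectSnd]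
  have h1 : ∀ x : ι → E × E, selectSnd Finset.univ x = fun i => (x i).2 := fun x => by
    funext i; simp [selectSnd]
  simp [h0, h1, MeasurableEquiv.arrowProdEquivProdArrow, Equiv.arrowProdEquivProdArrow]

theorem integrable_of_measurable_of_bound {Ω : Type*} [MeasurableSpace Ω] {P : Measure Ω}
    [IsFiniteMeasure P] {G : Type*} [NormedAddCommGroup G] [MeasurableSpace G] [BorelSpace G]
    [SecondCountableTopology G] {f : Ω → G} (hf : Measurable f) (b : ℝ) (hb : ∀ ω, ‖f ω‖ ≤ b) :
    Integrable f P :=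
  Integrable.of_bound hf.aestronglyMeasurable b (ae_of_all _ hb)

variable {μ}

/-- The original is moved to its copy one coordinate at a time. Exchanging the two copies at k flips
the sign of the increment, so twice the k-th term is an expectation of a product of two differences.
By 2ab ≤ a² + b² and a further exchange over `s`, it is at most the expected squared effect of
resampling k alone. -/
theorem integral_mul_sub_selectSnd_le {F : (ι → E) → ℝ} (hF : Measurable F) {b : ℝ}
    (hb : ∀ w, |F w| ≤ b) (s : Finset ι) :
    ∫ x, F (selectSnd ∅ x) * (F (selectSnd ∅ x) - F (selectSnd s x))
        ∂(Measure.pi fun i => (μ i).prod (μ i))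
      ≤ 1 / 2 * ∑ k ∈ s, ∫ x, (F (selectSnd ∅ x) - F (selectSnd {k} x)) ^ 2
        ∂(Measure.pi fun i => (μ i).prod (μ i)) := by
  set ν := Measure.pi fun i => (μ i).prod (μ i) with hν
  have hbd : ∀ (t : Finset ι) (x : ι → E × E), |F (selectSnd t x)| ≤ b := fun t x => hb _
  have hb0 : ∀ x : ι → E × E, 0 ≤ b := fun x => (abs_nonneg _).trans (hbd ∅ x)
  have hsub : ∀ (t u : Finset ι) (x : ι → E × E),
      |F (selectSnd t x) - F (selectSnd u x)| ≤ 2 * b := fun t u x =>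
    (abs_sub _ _).trans (by linarith [hbd t x, hbd u x])
  have hi : ∀ r t u v : Finset ι, Integrable (fun x => (F (selectSnd r x) - F (selectSnd t x))
      * (F (selectSnd u x) - F (selectSnd v x))) ν := fun r t u v => by
    refine integrable_of_measurable_of_bound (by fun_prop) (2 * b * (2 * b)) fun x => ?_
    rw [Real.norm_eq_abs, abs_mul]
    exact mul_le_mul (hsub _ _ _) (hsub _ _ _) (abs_nonneg _) (by linarith [hb0 x])
  have hi1 : ∀ r u v : Finset ι, Integrable (fun x => F (selectSnd r x)
      * (F (selectSnd u x) - F (selectSnd v x))) ν := fun r u v => by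
    refine integrable_of_measurable_of_bound (by fun_prop) (b * (2 * b)) fun x => ?_
    rw [Real.norm_eq_abs, abs_mul]
    exact mul_le_mul (hbd _ _) (hsub _ _ _) (abs_nonneg _) (hb0 x)
  have hi2 : ∀ r t : Finset ι,
      Integrable (fun x => (F (selectSnd r x) - F (selectSnd t x)) ^ 2) ν := fun r t => by
    simp_rw [sq]
    exact hi r t r t
  induction s using Finset.induction_on with
  | empty => simp
  | insert k s hk ih =>
    rw [Finset.sum_insert hk, mul_add]
    have hsplit : ∫ x, F (selectSnd ∅ x) * (F (selectSnd ∅ x) - F (selectSnd (insert k s) x)) ∂ν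
        = ∫ x, F (selectSnd ∅ x) * (F (selectSnd ∅ x) - F (selectSnd s x)) ∂ν
        + ∫ x, F (selectSnd ∅ x) * (F (selectSnd s x) - F (selectSnd (insert k s) x)) ∂ν := by
      rw [← integral_add (hi1 _ _ _) (hi1 _ _ _)]
      congr 1
      funext x
      ring
    have hd1 : symmDiff s {k} = insert k s := by
      ext i; by_cases h : i = k <;> simp [Finset.mem_symmDiff, h, hk]
    have hd2 : symmDiff (insert k s) {k} = s := by
      rw [← hd1, symmDiff_symmDiff_cancel_right]
    have hd3 : symmDiff {k} s = insert k s := by rw [symmDiff_comm, hd1]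
    have hd4 : ∀ t : Finset ι, symmDiff ∅ t = t := fun t => bot_symmDiff t
    have hcomp : ∀ (t : Finset ι) (g : (ι → E × E) → ℝ), Measurable g →
        ∫ x, g (swapOn t x) ∂ν = ∫ x, g x ∂ν := fun t g hg => by
      have hp : MeasurePreserving (swapOn t) ν ν := measurePreserving_swapOn μ t
      conv_rhs => rw [← hp.map_eq]
      rw [integral_map hp.measurable.aemeasurable hg.aestronglyMeasurable]
    have hJ : ∫ x, F (selectSnd ∅ x) * (F (selectSnd s x) - F (selectSnd (insert k s) x)) ∂ν
        = ∫ x, F (selectSnd {k} x) * (F (selectSnd (insert k s) x) - F (selectSnd s x)) ∂ν := by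
      rw [← hcomp {k} _ (by fun_prop)]
      simp only [selectSnd_swapOn, hd1, hd2, hd4]
    -- Exchanging the copies on `s` turns the selections ∅ and {k} into `s` and `insert k s`.
    have hS : ∫ x, (F (selectSnd s x) - F (selectSnd (insert k s) x)) ^ 2 ∂ν
        = ∫ x, (F (selectSnd ∅ x) - F (selectSnd {k} x)) ^ 2 ∂ν := by
      rw [← hcomp s (fun x => (F (selectSnd ∅ x) - F (selectSnd {k} x)) ^ 2) (by fun_prop)]
      simp only [selectSnd_swapOn, hd3, hd4]
    have h2J : 2 * ∫ x, F (selectSnd ∅ x)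
          * (F (selectSnd s x) - F (selectSnd (insert k s) x)) ∂ν
        = ∫ x, (F (selectSnd ∅ x) - F (selectSnd {k} x))
          * (F (selectSnd s x) - F (selectSnd (insert k s) x)) ∂ν := by
      rw [two_mul]
      nth_rewrite 2 [hJ]
      rw [← integral_add (hi1 _ _ _) (hi1 _ _ _)]
      congr 1
      funext x
      ring
    have hle : ∫ x, (F (selectSnd ∅ x) - F (selectSnd {k} x))
          * (F (selectSnd s x) - F (selectSnd (insert k s) x)) ∂ν
        ≤ ∫ x, 1 / 2 * ((F (selectSnd ∅ x) - F (selectSnd {k} x)) ^ 2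
          + (F (selectSnd s x) - F (selectSnd (insert k s) x)) ^ 2) ∂ν := by
      refine integral_mono (hi _ _ _ _) (((hi2 _ _).add (hi2 _ _)).const_mul _) fun x => ?_
      have := two_mul_le_add_sq (F (selectSnd ∅ x) - F (selectSnd {k} x))
        (F (selectSnd s x) - F (selectSnd (insert k s) x))
      dsimp only
      linarith
    rw [integral_const_mul, integral_add (hi2 _ _) (hi2 _ _), hS] at hle
    rw [hsplit]
    linarith

/-- The Efron–Stein inequality for bounded real functions. -/
theorem integral_sub_integral_sq_le {F : (ι → E) → ℝ} (hF : Measurable F) {b : ℝ}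
    (hb : ∀ w, |F w| ≤ b) {C : ℝ}
    (hC : ∀ w v : ι → E, ∑ k, (F w - F (Function.update w k (v k))) ^ 2 ≤ C) :
    ∫ w, (F w - ∫ w, F w ∂Measure.pi μ) ^ 2 ∂Measure.pi μ ≤ C / 2 := by
  set ν := Measure.pi fun i => (μ i).prod (μ i) with hν
  set a := ∫ w, F w ∂Measure.pi μ with ha
  have hFi : Integrable F (Measure.pi μ) := integrable_of_measurable_of_bound hF b hb
  have hFi2 : Integrable (fun w => F w ^ 2) (Measure.pi μ) :=
    integrable_of_measurable_of_bound (by fun_prop) (b ^ 2) fun w => by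
      rw [norm_pow]
      exact pow_le_pow_left₀ (norm_nonneg _) (hb w) 2
  have hbd : ∀ (t : Finset ι) (x : ι → E × E), |F (selectSnd t x)| ≤ b := fun t x => hb _
  have h1 : ∫ w, (F w - a) ^ 2 ∂Measure.pi μ = ∫ w, F w ^ 2 ∂Measure.pi μ - a ^ 2 := by
    have : ∀ w, (F w - a) ^ 2 = F w ^ 2 - (2 * a) * F w + a ^ 2 := fun w => by ring
    simp_rw [this]
    rw [integral_add (f := fun w => F w ^ 2 - 2 * a * F w) (hFi2.sub (hFi.const_mul _))
      (integrable_const _), integral_sub hFi2 (hFi.const_mul _), integral_const_mul, ← ha]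
    simp
    ring
  have hp := measurePreserving_selectSnd μ (∅ : Finset ι)
  have h2 : ∫ w, F w ^ 2 ∂Measure.pi μ = ∫ x, F (selectSnd ∅ x) ^ 2 ∂ν := by
    conv_lhs => rw [← hp.map_eq]
    rw [integral_map hp.measurable.aemeasurable (by fun_prop)]
  -- The square of the mean is E[F F'] with F' evaluated at the fully resampled point, so the
  -- variance is E[F(F - F')].
  have h3 : ∫ x, F (selectSnd ∅ x) ^ 2 ∂ν - a ^ 2
      = ∫ x, F (selectSnd ∅ x) * (F (selectSnd ∅ x) - F (selectSnd Finset.univ x)) ∂ν := by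
    rw [ha, ← integral_selectSnd_mul_univ μ F, ← integral_sub]
    · congr 1
      funext x
      ring
    · exact integrable_of_measurable_of_bound (by fun_prop) (b ^ 2) fun x => by
        rw [norm_pow]
        exact pow_le_pow_left₀ (norm_nonneg _) (hbd _ x) 2
    · exact integrable_of_measurable_of_bound (by fun_prop) (b * b) fun x => by
        rw [norm_mul]
        exact mul_le_mul (hbd _ _) (hbd _ _) (abs_nonneg _) ((abs_nonneg _).trans (hbd ∅ x))
  rw [h1, h2, h3]
  refine (integral_mul_sub_selectSnd_le hF hb _).trans ?_
  have hi2 : ∀ r t : Finset ι,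
      Integrable (fun x => (F (selectSnd r x) - F (selectSnd t x)) ^ 2) ν := fun r t => by
    refine integrable_of_measurable_of_bound (by fun_prop) ((2 * b) ^ 2) fun x => ?_
    rw [norm_pow]
    refine pow_le_pow_left₀ (norm_nonneg _) ?_ 2
    exact (abs_sub _ _).trans (by linarith [hbd r x, hbd t x])
  rw [← integral_finsetSum _ fun k _ => hi2 _ _]
  have h4 : ∫ x, ∑ k, (F (selectSnd ∅ x) - F (selectSnd {k} x)) ^ 2 ∂ν ≤ ∫ _x, C ∂ν := by
    refine integral_mono (integrable_finsetSum _ fun k _ => hi2 _ _) (integrable_const _)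
      fun x => ?_
    refine le_trans (le_of_eq ?_) (hC (selectSnd ∅ x) (selectSnd Finset.univ x))
    refine Finset.sum_congr rfl fun k _ => ?_
    rw [selectSnd_singleton]
    simp [selectSnd]
  rw [integral_const, probReal_univ, one_smul] at h4
  linarith

/-- The Efron–Stein inequality for bounded complex functions. -/
theorem integral_norm_sub_integral_sq_le {F : (ι → E) → ℂ} (hF : Measurable F) {b : ℝ}
    (hb : ∀ w, ‖F w‖ ≤ b) {C : ℝ}
    (hC : ∀ w v : ι → E, ∑ k, ‖F w - F (Function.update w k (v k))‖ ^ 2 ≤ C) :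
    ∫ w, ‖F w - ∫ w, F w ∂Measure.pi μ‖ ^ 2 ∂Measure.pi μ ≤ C := by
  have hFi : Integrable F (Measure.pi μ) := integrable_of_measurable_of_bound hF b hb
  set a := ∫ w, F w ∂Measure.pi μ with ha
  have hre : ∫ w, (F w).re ∂Measure.pi μ = a.re := integral_re hFi
  have him : ∫ w, (F w).im ∂Measure.pi μ = a.im := integral_im hFi
  -- The real and imaginary parts each contribute at most C/2.
  have h1 := integral_sub_integral_sq_le (μ := μ) (F := fun w => (F w).re) (by fun_prop)
    (fun w => (Complex.abs_re_le_norm _).trans (hb w)) (C := C) fun w v => by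
      refine le_trans (Finset.sum_le_sum fun k _ => ?_) (hC w v)
      rw [← Complex.sub_re, ← sq_abs]
      exact pow_le_pow_left₀ (abs_nonneg _) (Complex.abs_re_le_norm _) 2
  have h2 := integral_sub_integral_sq_le (μ := μ) (F := fun w => (F w).im) (by fun_prop)
    (fun w => (Complex.abs_im_le_norm _).trans (hb w)) (C := C) fun w v => by
      refine le_trans (Finset.sum_le_sum fun k _ => ?_) (hC w v)
      rw [← Complex.sub_im, ← sq_abs]
      exact pow_le_pow_left₀ (abs_nonneg _) (Complex.abs_im_le_norm _) 2
  rw [hre] at h1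
  rw [him] at h2
  have hsub : ∀ w, ‖F w - a‖ ≤ b + ‖a‖ := fun w =>
    (norm_sub_le _ _).trans (by linarith [hb w])
  have h3 : ∀ w, ‖F w - a‖ ^ 2 = ((F w).re - a.re) ^ 2 + ((F w).im - a.im) ^ 2 := fun w => by
    rw [← Complex.normSq_eq_norm_sq, Complex.normSq_apply, Complex.sub_re, Complex.sub_im]
    ring
  simp_rw [h3]
  rw [integral_add]
  · linarith
  · refine integrable_of_measurable_of_bound (by fun_prop) ((b + ‖a‖) ^ 2) fun w => ?_
    rw [norm_pow, ← Complex.sub_re]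
    exact pow_le_pow_left₀ (norm_nonneg _) ((Complex.abs_re_le_norm _).trans (hsub w)) 2
  · refine integrable_of_measurable_of_bound (by fun_prop) ((b + ‖a‖) ^ 2) fun w => ?_
    rw [norm_pow, ← Complex.sub_im]
    exact pow_le_pow_left₀ (norm_nonneg _) ((Complex.abs_im_le_norm _).trans (hsub w)) 2

end EfronStein

/-! ### Moments and measurability of the empirical spectral distribution. -/

section EmpiricalSpectralDistribution

open Matrix
open scoped Matrix.Norms.Frobenius

theorem isHermitian_hermMat {n : ℕ} (A : HermMat n) : A.1.IsHermitian := A.2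

theorem coe_esd {n : ℕ} (hn : n ≠ 0) (A : HermMat n) : (esd A : Measure ℝ) = esdMeasure A := by
  have h : esd A = ⟨esdMeasure A, isProbabilityMeasure_esdMeasure hn A⟩ := dif_neg hn
  rw [h]
  rfl

theorem integral_esdMeasure {n : ℕ} (A : HermMat n) (f : ℝ → ℂ) :
    ∫ x, f x ∂esdMeasure A = (n : ℂ)⁻¹ * ∑ i, f ((isHermitian_hermMat A).eigenvalues i) := by
  rw [esdMeasure, integral_smul_measure, integral_finsetSum_measure]
  · simp [integral_dirac]
  · intro i _
    exact integrable_dirac (by finiteness)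

theorem integral_cayley_pow_esdMeasure {n : ℕ} (A : HermMat n) (k : ℕ) :
    ∫ x, cayley x ^ k ∂esdMeasure A
      = (n : ℂ)⁻¹ * (cayleyMat (isHermitian_hermMat A) ^ k).trace := by
  rw [integral_esdMeasure, cayleyMat, specFun_pow, trace_specFun]
  rfl

theorem lintegral_esdMeasure {n : ℕ} (A : HermMat n) (f : ℝ → ℝ≥0∞) :
    ∫⁻ x, f x ∂esdMeasure A
      = (n : ℝ≥0∞)⁻¹ * ∑ i, f ((isHermitian_hermMat A).eigenvalues i) := by
  rw [esdMeasure, lintegral_smul_measure, lintegral_finsetSum_measure]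
  simp [lintegral_dirac]

theorem sum_eigenvalues_pow {m : Type*} [Fintype m] [DecidableEq m] {A : Matrix m m ℂ}
    (hA : A.IsHermitian) (k : ℕ) : ∑ i, hA.eigenvalues i ^ k = ((A ^ k).trace).re := by
  have h := trace_specFun hA (Complex.ofReal ^ k)
  rw [← specFun_pow, specFun_ofReal] at h
  rw [h, Complex.re_sum]
  refine Finset.sum_congr rfl fun i _ => ?_
  rw [Pi.pow_apply, ← Complex.ofReal_pow, Complex.ofReal_re]

theorem sum_eigenvalues_sq {m : Type*} [Fintype m] [DecidableEq m] {A : Matrix m m ℂ}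
    (hA : A.IsHermitian) : ∑ i, hA.eigenvalues i ^ 2 = ‖A‖ ^ 2 := by
  have h := trace_conjTranspose_mul_self A
  rw [hA.eq, ← sq] at h
  rw [sum_eigenvalues_pow, h, Complex.ofReal_re]

theorem lintegral_sq_esdMeasure {n : ℕ} (A : HermMat n) :
    ∫⁻ x, ENNReal.ofReal (x ^ 2) ∂esdMeasure A
      = (n : ℝ≥0∞)⁻¹ * ENNReal.ofReal (‖A.1‖ ^ 2) := by
  rw [lintegral_esdMeasure, ← ENNReal.ofReal_sum_of_nonneg fun i _ => sq_nonneg _,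
    sum_eigenvalues_sq]

/-- Sums of polynomials over the eigenvalues are combinations of traces of powers, hence measurable
in the entries. Pointwise approximation of half-line indicators carries this over to eigenvalue
counts, without any measurable choice of eigenvalues. -/
theorem exists_polynomial_tendsto_indicator_Iic (a : ℝ) :
    ∃ p : ℕ → Polynomial ℝ, ∀ x, Tendsto (fun j => (p j).eval x) atTop
      (𝓝 ((Set.Iic a).indicator (fun _ => 1) x)) := by
  -- Ramps of slope -j descending from 1 at `a`, to be approximated by Weierstrass on [-j, j] within
  -- 1/(j+1).
  let g : ℕ → ℝ → ℝ := fun j x => max 0 (1 - j * max 0 (x - a))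
  have hp : ∀ j : ℕ, ∃ p : Polynomial ℝ, ∀ x ∈ Set.Icc (-(j : ℝ)) j,
      |p.eval x - g j x| < 1 / ((j : ℝ) + 1) := fun j =>
    exists_polynomial_near_of_continuousOn _ _ _ (by fun_prop) _ (by positivity)
  choose p hp using hp
  refine ⟨p, fun x => ?_⟩
  have hg : Tendsto (fun j => g j x) atTop (𝓝 ((Set.Iic a).indicator (fun _ => 1) x)) := by
    rcases le_or_gt x a with h | h
    · rw [Set.indicator_of_mem (Set.mem_Iic.2 h)]
      have : ∀ j, g j x = 1 := fun j => by simp [g, max_eq_left (sub_nonpos.2 h)]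
      simp_rw [this]
      exact tendsto_const_nhds
    · rw [Set.indicator_of_notMem (by simpa using h)]
      refine tendsto_const_nhds.congr' ?_
      obtain ⟨N, hN⟩ := exists_nat_gt (1 / (x - a))
      filter_upwards [eventually_ge_atTop N] with j hj
      have hxa : 0 < x - a := sub_pos.2 h
      have h1 : (1 : ℝ) ≤ j * (x - a) := by
        rw [div_lt_iff₀ hxa] at hN
        have : (N : ℝ) ≤ j := by exact_mod_cast hj
        nlinarith
      simp only [g, max_eq_right hxa.le]
      rw [max_eq_left (by linarith)]
  have hd : Tendsto (fun j => (p j).eval x - g j x) atTop (𝓝 0) := by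
    refine squeeze_zero_norm' ?_ (tendsto_one_div_add_atTop_nhds_zero_nat (𝕜 := ℝ))
    obtain ⟨N, hN⟩ := exists_nat_gt |x|
    filter_upwards [eventually_ge_atTop N] with j hj
    have : (N : ℝ) ≤ j := by exact_mod_cast hj
    exact (hp j x (abs_le.1 (hN.le.trans this))).le
  simpa using hd.add hg

variable {Ω : Type*} [MeasurableSpace Ω]

theorem measurable_trace_pow {n : ℕ} {A : Ω → HermMat n}
    (hA : ∀ i j, Measurable fun ω => (A ω).1 i j) (k : ℕ) :
    Measurable fun ω => ((A ω).1 ^ k).trace := by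
  have h : ∀ i j, Measurable fun ω => ((A ω).1 ^ k) i j := by
    induction k with
    | zero => simp
    | succ k ih =>
      intro i j
      simp only [pow_succ, mul_apply]
      exact Finset.measurable_sum _ fun l _ => (ih i l).mul (hA l j)
  exact Finset.measurable_sum _ fun i _ => h i i

theorem measurable_sum_polynomial_eigenvalues {n : ℕ} {A : Ω → HermMat n}
    (hA : ∀ i j, Measurable fun ω => (A ω).1 i j) (p : Polynomial ℝ) :
    Measurable fun ω => ∑ i, p.eval ((isHermitian_hermMat (A ω)).eigenvalues i) := by
  have h : ∀ ω, ∑ i, p.eval ((isHermitian_hermMat (A ω)).eigenvalues i)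
      = ∑ k ∈ Finset.range (p.natDegree + 1), p.coeff k * (((A ω).1 ^ k).trace).re := fun ω => by
    simp_rw [Polynomial.eval_eq_sum_range]
    rw [Finset.sum_comm]
    refine Finset.sum_congr rfl fun k _ => ?_
    rw [← Finset.mul_sum, sum_eigenvalues_pow]
  simp_rw [h]
  refine Finset.measurable_sum _ fun k _ => ?_
  have := measurable_trace_pow hA k
  fun_prop

theorem measurable_esdMeasure {n : ℕ} (hn : n ≠ 0) {A : Ω → HermMat n}
    (hA : ∀ i j, Measurable fun ω => (A ω).1 i j) : Measurable fun ω => esdMeasure (A ω) := by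
  have : ∀ ω, IsProbabilityMeasure (esdMeasure (A ω)) := fun ω =>
    isProbabilityMeasure_esdMeasure hn (A ω)
  refine .measure_of_isPiSystem_of_isProbabilityMeasure (borel_eq_generateFrom_Iic ℝ)
    isPiSystem_Iic ?_
  rintro _ ⟨a, rfl⟩
  obtain ⟨p, hp⟩ := exists_polynomial_tendsto_indicator_Iic a
  have hlim : Measurable fun ω => ∑ i, (Set.Iic a).indicator (fun _ => (1 : ℝ))
      ((isHermitian_hermMat (A ω)).eigenvalues i) := by
    refine measurable_of_tendsto_metrizable
      (fun j => measurable_sum_polynomial_eigenvalues hA (p j)) ?_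
    rw [tendsto_pi_nhds]
    exact fun ω => tendsto_finsetSum _ fun i _ => hp _
  have h : ∀ ω, esdMeasure (A ω) (Set.Iic a)
      = (n : ℝ≥0∞)⁻¹ * ENNReal.ofReal (∑ i, (Set.Iic a).indicator (fun _ => (1 : ℝ))
      ((isHermitian_hermMat (A ω)).eigenvalues i)) := fun ω => by
    rw [← lintegral_indicator_one measurableSet_Iic, lintegral_esdMeasure,
      ENNReal.ofReal_sum_of_nonneg fun i _ => Set.indicator_nonneg (fun _ _ => zero_le_one) _]
    congr 1
    refine Finset.sum_congr rfl fun i _ => ?_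
    by_cases hx : (isHermitian_hermMat (A ω)).eigenvalues i ∈ Set.Iic a
    · rw [Set.indicator_of_mem hx, Set.indicator_of_mem hx]
      simp
    · rw [Set.indicator_of_notMem hx, Set.indicator_of_notMem hx]
      simp
  simp_rw [h]
  fun_prop

theorem measurable_coe_esd {n : ℕ} {A : Ω → HermMat n}
    (hA : ∀ i j, Measurable fun ω => (A ω).1 i j) :
    Measurable fun ω => (esd (A ω) : Measure ℝ) := by
  rcases eq_or_ne n 0 with rfl | hn
  · simp only [esd]
    exact measurable_const
  · simp_rw [coe_esd hn]
    exact measurable_esdMeasure hn hA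

theorem exists_isMeanMeasure (P : Measure Ω) [IsProbabilityMeasure P]
    {L : Ω → ProbabilityMeasure ℝ} (hL : Measurable fun ω => (L ω : Measure ℝ)) :
    ∃ ν : ProbabilityMeasure ℝ, IsMeanMeasure P L ν := by
  refine ⟨⟨P.bind fun ω => (L ω : Measure ℝ), ⟨?_⟩⟩, fun s hs => ?_⟩
  · rw [Measure.bind_apply .univ hL.aemeasurable]
    simp
  · exact Measure.bind_apply hs hL.aemeasurable

theorem IsMeanMeasure.coe_eq_bind {P : Measure Ω} {L : Ω → ProbabilityMeasure ℝ}
    (hL : Measurable fun ω => (L ω : Measure ℝ)) {ν : ProbabilityMeasure ℝ}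
    (h : IsMeanMeasure P L ν) : (ν : Measure ℝ) = P.bind fun ω => (L ω : Measure ℝ) := by
  ext s hs
  rw [h s hs, Measure.bind_apply hs hL.aemeasurable]

theorem IsMeanMeasure.integral_eq {P : Measure Ω} [IsProbabilityMeasure P]
    {L : Ω → ProbabilityMeasure ℝ}
    (hL : Measurable fun ω => (L ω : Measure ℝ)) {ν : ProbabilityMeasure ℝ}
    (h : IsMeanMeasure P L ν) {f : ℝ → ℂ} (hf : Measurable f) {b : ℝ} (hb : ∀ x, ‖f x‖ ≤ b) :
    ∫ x, f x ∂(ν : Measure ℝ) = ∫ ω, ∫ x, f x ∂(L ω : Measure ℝ) ∂P := by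
  let κ : Kernel Ω ℝ := ⟨fun ω => (L ω : Measure ℝ), hL⟩
  have hν : (ν : Measure ℝ) = (κ ∘ₖ Kernel.const Unit P) () := by
    rw [h.coe_eq_bind hL, ← Measure.comp_eq_comp_const_apply]
    rfl
  have hi : Integrable f ((κ ∘ₖ Kernel.const Unit P) ()) := by
    rw [← hν]
    exact integrable_of_measurable_of_bound hf b hb
  rw [hν, Kernel.integral_comp hi]
  simp [κ]

theorem measurable_integral_of_measurable {L : Ω → ProbabilityMeasure ℝ}
    (hL : Measurable fun ω => (L ω : Measure ℝ)) {f : ℝ → ℂ} (hf : Measurable f) :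
    Measurable fun ω => ∫ x, f x ∂(L ω : Measure ℝ) := by
  let κ : Kernel Ω ℝ := ⟨fun ω => (L ω : Measure ℝ), hL⟩
  have : IsMarkovKernel κ := ⟨fun ω => inferInstanceAs (IsProbabilityMeasure (L ω : Measure ℝ))⟩
  have h : StronglyMeasurable fun ω => ∫ x, f x ∂κ ω :=
    hf.stronglyMeasurable.integral_kernel (κ := κ)
  exact h.measurable

end EmpiricalSpectralDistribution

/-! ### Effect of resampling one variable of a patterned matrix. -/

section PatternedMatrices

open Matrix
open scoped Matrix.Norms.Frobenius

section disjointPattern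

variable {m ι : Type*} [Fintype m] [DecidableEq m] [Fintype ι] [DecidableEq ι]
  {key : m → m → ι} {D : ι → Matrix m m ℂ}

/-- `D z` sees only the block of `G` on the transposed positions with key z. These blocks are
disjoint, so their squared norms add up to ‖G‖² and Cauchy–Schwarz can be applied block by block
with no loss in the number of keys. -/
theorem sum_norm_trace_mul_sq_le (hD : ∀ z i j, key i j ≠ z → D z i j = 0) (G : Matrix m m ℂ)
    {b : ℝ} (hb : ∀ z, ‖D z‖ ^ 2 ≤ b) :
    ∑ z, ‖(G * D z).trace‖ ^ 2 ≤ ‖G‖ ^ 2 * b := by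
  let R : ι → Matrix m m ℂ := fun z => Matrix.of fun i j => if key j i = z then G i j else 0
  have h1 : ∀ z, (G * D z).trace = (R z * D z).trace := fun z => by
    simp only [Matrix.trace, diag_apply, mul_apply]
    refine Finset.sum_congr rfl fun i _ => Finset.sum_congr rfl fun j _ => ?_
    by_cases h : key j i = z
    · simp [R, h]
    · simp [R, h, hD z j i h]
  have h2 : ∑ z, ‖R z‖ ^ 2 = ‖G‖ ^ 2 := by
    simp_rw [frobenius_norm_sq]
    rw [Finset.sum_comm]
    refine Finset.sum_congr rfl fun i _ => ?_
    rw [Finset.sum_comm]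
    refine Finset.sum_congr rfl fun j _ => ?_
    rw [Finset.sum_eq_single (key j i)]
    · simp [R]
    · intro z _ hz
      simp [R, hz.symm]
    · simp
  rw [← h2, Finset.sum_mul]
  refine Finset.sum_le_sum fun z _ => ?_
  rw [h1]
  calc ‖(R z * D z).trace‖ ^ 2 ≤ (‖R z‖ * ‖D z‖) ^ 2 :=
        pow_le_pow_left₀ (norm_nonneg _) (norm_trace_mul_le _ _) 2
    _ = ‖R z‖ ^ 2 * ‖D z‖ ^ 2 := mul_pow _ _ _
    _ ≤ _ := by gcongr; exact hb z

omit [Fintype ι] in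
theorem norm_sq_le_of_pattern (hD : ∀ z i j, key i j ≠ z → D z i j = 0) {c : ℝ}
    (hc : ∀ z i j, ‖D z i j‖ ≤ c) (z : ι) :
    ‖D z‖ ^ 2 ≤ c ^ 2 * (Finset.univ.filter fun p : m × m => key p.1 p.2 = z).card := by
  rw [frobenius_norm_sq, ← Fintype.sum_prod_type']
  have h : ∀ p : m × m, ‖D z p.1 p.2‖ ^ 2 ≤ if key p.1 p.2 = z then c ^ 2 else 0 := fun p => by
    split_ifs with h
    · exact pow_le_pow_left₀ (norm_nonneg _) (hc _ _ _) 2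
    · simp [hD z _ _ h]
  refine (Finset.sum_le_sum fun p _ => h p).trans (le_of_eq ?_)
  rw [← Finset.sum_filter, Finset.sum_const, nsmul_eq_mul, mul_comm]

theorem sum_norm_sq_le_of_pattern (hD : ∀ z i j, key i j ≠ z → D z i j = 0) {c : ℝ}
    (hc : ∀ z i j, ‖D z i j‖ ≤ c) : ∑ z, ‖D z‖ ^ 2 ≤ c ^ 2 * (Fintype.card m) ^ 2 := by
  refine (Finset.sum_le_sum fun z _ => norm_sq_le_of_pattern hD hc z).trans (le_of_eq ?_)
  rw [← Finset.mul_sum, ← Nat.cast_sum, ← Finset.card_eq_sum_card_fiberwise (fun _ _ => by simp),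
    Finset.card_univ, Fintype.card_prod]
  push_cast
  ring

end disjointPattern

/-- The Hermitian matrix with entries `w (I i j)` for `i < j` and `re (w (I i i))` on the
diagonal. -/
noncomputable def patternedMat {ι : Type*} {n : ℕ} (I : Fin n → Fin n → ι) (w : ι → ℂ) :
    HermMat n :=
  ⟨Matrix.of fun i j => if i < j then w (I i j) else if j < i then star (w (I j i))
    -- The real part makes the matrix Hermitian for every `w`, in particular after resampling.
    else ((w (I i i)).re : ℂ), by
      ext i j
      rcases lt_trichotomy i j with h | rfl | h
      · simp [star_apply, h, h.not_gt]
      · simp [star_apply]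
      · simp [star_apply, h, h.not_gt]⟩

/-- Replace `z` by zero if `‖z‖ > M`. -/
noncomputable def truncate (M : ℝ) (z : ℂ) : ℂ := if ‖z‖ ≤ M then z else 0

theorem norm_truncate_le {M : ℝ} (hM : 0 ≤ M) (z : ℂ) : ‖truncate M z‖ ≤ M := by
  unfold truncate
  split_ifs with h
  · exact h
  · simpa using hM

@[fun_prop]
theorem measurable_truncate (M : ℝ) : Measurable (truncate M) :=
  Measurable.ite (measurableSet_le (by fun_prop) (by fun_prop)) measurable_id measurable_const

/-- The symmetrized link function. -/
def symmetrizedLink {ι : Type*} {n : ℕ} (I : Fin n → Fin n → ι) (i j : Fin n) : ι :=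
  if i < j then I i j else I j i

theorem patternedMat_apply_eq {ι : Type*} {n : ℕ} (I : Fin n → Fin n → ι) {w w' : ι → ℂ}
    {i j : Fin n} (h : w (symmetrizedLink I i j) = w' (symmetrizedLink I i j)) :
    (patternedMat I w).1 i j = (patternedMat I w').1 i j := by
  rcases lt_trichotomy i j with hij | rfl | hij
  · simp_all [symmetrizedLink, patternedMat]
  · simp_all [symmetrizedLink, patternedMat]
  · simp_all [symmetrizedLink, patternedMat, hij.not_gt]

theorem norm_patternedMat_apply_le {ι : Type*} {n : ℕ} (I : Fin n → Fin n → ι) (w : ι → ℂ)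
    (i j : Fin n) : ‖(patternedMat I w).1 i j‖ ≤ ‖w (symmetrizedLink I i j)‖ := by
  rcases lt_trichotomy i j with hij | rfl | hij
  · simp [symmetrizedLink, patternedMat, hij]
  · simpa [symmetrizedLink, patternedMat] using Complex.abs_re_le_norm _
  · simp [symmetrizedLink, patternedMat, hij, hij.not_gt]

theorem patternedMat_sub {ι : Type*} {n : ℕ} (I : Fin n → Fin n → ι) (w w' : ι → ℂ) :
    patternedMat I w - patternedMat I w' = patternedMat I (w - w') := by
  ext i j
  rcases lt_trichotomy i j with hij | rfl | hij
  · simp [patternedMat, hij]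
  · simp [patternedMat]
  · simp [patternedMat, hij, hij.not_gt]

theorem measurable_patternedMat_apply {ι : Type*} {n : ℕ} (I : Fin n → Fin n → ι) (i j : Fin n) :
    Measurable fun w : ι → ℂ => (patternedMat I w).1 i j := by
  simp only [patternedMat, of_apply]
  split_ifs <;> fun_prop

theorem card_symmetrizedLink_fiber_le {ι : Type*} [DecidableEq ι] {n : ℕ}
    (I : Fin n → Fin n → ι) (z : ι) :
    (Finset.univ.filter fun p : Fin n × Fin n => symmetrizedLink I p.1 p.2 = z).card
      ≤ 2 * (Finset.univ.filter fun p : Fin n × Fin n => I p.1 p.2 = z).card := by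
  set S := Finset.univ.filter fun p : Fin n × Fin n => I p.1 p.2 = z with hS
  have h : (Finset.univ.filter fun p : Fin n × Fin n => symmetrizedLink I p.1 p.2 = z)
      ⊆ S ∪ S.image Prod.swap := by
    rintro ⟨i, j⟩ hp
    replace hp := (Finset.mem_filter.1 hp).2
    simp only [symmetrizedLink] at hp
    simp only [Finset.mem_union, Finset.mem_image, hS, Finset.mem_filter, Finset.mem_univ,
      true_and]
    split_ifs at hp
    · exact .inl hp
    · exact .inr ⟨(j, i), hp, rfl⟩
  refine (Finset.card_le_card h).trans ((Finset.card_union_le _ _).trans ?_)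
  have := Finset.card_image_le (s := S) (f := Prod.swap)
  omega

/-- The `k`-th Cayley moment of the empirical spectral distribution of `A / √n`. -/
noncomputable def cayleyMoment {n : ℕ} (k : ℕ) (A : HermMat n) : ℂ :=
  ∫ x, cayley x ^ k ∂(esd ((1 / √(n : ℝ)) • A) : Measure ℝ)

theorem norm_integral_cayley_pow_le (ν : ProbabilityMeasure ℝ) (k : ℕ) :
    ‖∫ x, cayley x ^ k ∂(ν : Measure ℝ)‖ ≤ 1 := by
  refine (norm_integral_le_of_norm_le_const (C := 1) (ae_of_all _ fun x => ?_)).trans ?_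
  · simp [norm_cayley]
  · simp

theorem norm_cayleyMoment_le {n : ℕ} (k : ℕ) (A : HermMat n) : ‖cayleyMoment k A‖ ≤ 1 :=
  norm_integral_cayley_pow_le _ k

theorem cayleyMoment_eq {n : ℕ} (hn : n ≠ 0) (k : ℕ) (A : HermMat n) :
    cayleyMoment k A = (n : ℂ)⁻¹
      * (cayleyMat (isHermitian_hermMat ((1 / √(n : ℝ)) • A)) ^ k).trace := by
  rw [cayleyMoment, coe_esd hn, integral_cayley_pow_esdMeasure]

theorem norm_scale_sub_sq {n : ℕ} (A B : HermMat n) :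
    ‖((1 / √(n : ℝ)) • B).1 - ((1 / √(n : ℝ)) • A).1‖ ^ 2 = 1 / n * ‖(B - A).1‖ ^ 2 := by
  have h : ((1 / √(n : ℝ)) • B).1 - ((1 / √(n : ℝ)) • A).1 = (1 / √(n : ℝ)) • (B - A).1 := by
    change (1 / √(n : ℝ)) • B.1 - (1 / √(n : ℝ)) • A.1 = (1 / √(n : ℝ)) • (B.1 - A.1)
    rw [smul_sub]
  rw [h, norm_smul, mul_pow, Real.norm_eq_abs, sq_abs, div_pow, Real.sq_sqrt (by positivity),
    one_pow]

/-- This first-order bound is used to discard the truncation. The quantity under the root is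
normalized as in condition L. -/
theorem norm_cayleyMoment_sub_le {n : ℕ} (hn : n ≠ 0) (k : ℕ) (A B : HermMat n) :
    ‖cayleyMoment k B - cayleyMoment k A‖
      ≤ 2 * k * √(1 / (n : ℝ) ^ 2 * ‖(B - A).1‖ ^ 2) := by
  have hn0 : (0 : ℝ) < n := by positivity
  rw [cayleyMoment_eq hn, cayleyMoment_eq hn, ← mul_sub, norm_mul]
  have h := norm_trace_cayleyMat_pow_sub_le (isHermitian_hermMat ((1 / √(n : ℝ)) • A))
    (isHermitian_hermMat ((1 / √(n : ℝ)) • B)) k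
  have h2 : ‖((1 / √(n : ℝ)) • B).1 - ((1 / √(n : ℝ)) • A).1‖ = √(1 / n) * ‖(B - A).1‖ := by
    rw [← Real.sqrt_sq (norm_nonneg (((1 / √(n : ℝ)) • B).1 - _)), norm_scale_sub_sq,
      Real.sqrt_mul (by positivity), Real.sqrt_sq (norm_nonneg _)]
  rw [h2, Fintype.card_fin] at h
  have h3 : √(1 / (n : ℝ) ^ 2 * ‖(B - A).1‖ ^ 2) = 1 / n * ‖(B - A).1‖ := by
    rw [← _root_.one_div_pow, ← mul_pow, Real.sqrt_sq (by positivity)]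
  have h4 : √(n : ℝ) * √(1 / n) = 1 := by
    rw [← Real.sqrt_mul hn0.le, mul_one_div_cancel hn0.ne', Real.sqrt_one]
  rw [h3, norm_inv, Complex.norm_natCast]
  calc _ ≤ (n : ℝ)⁻¹ * (√n * (k * (2 * (√(1 / n) * ‖(B - A).1‖)))) := by gcongr
    _ = (√(n : ℝ) * √(1 / n)) * (2 * k * (1 / n * ‖(B - A).1‖)) := by ring
    _ = _ := by rw [h4, one_mul]

theorem exists_cayleyMoment_expansion {n : ℕ} (hn : n ≠ 0) (k : ℕ) (A : HermMat n) :
    ∃ G : Matrix (Fin n) (Fin n) ℂ, ‖G‖ ^ 2 ≤ (2 * k) ^ 2 * n ∧ ∀ B : HermMat n,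
      ‖cayleyMoment k B - cayleyMoment k A‖ ^ 2
        ≤ 2 / (n : ℝ) ^ 2 * (1 / n * ‖(G * (B - A).1).trace‖ ^ 2
          + (4 * k ^ 2 + 2 * k) ^ 2 * (1 / n * ‖(B - A).1‖ ^ 2) ^ 2) := by
  have hn0 : (0 : ℝ) < n := by positivity
  obtain ⟨G, hG, h⟩ := exists_trace_cayleyMat_expansion
    (isHermitian_hermMat ((1 / √(n : ℝ)) • A)) k
  refine ⟨G, by simpa using hG, fun B => ?_⟩
  have hB := h (isHermitian_hermMat ((1 / √(n : ℝ)) • B))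
  have hs : ((1 / √(n : ℝ)) • B).1 - ((1 / √(n : ℝ)) • A).1 = (1 / √(n : ℝ)) • (B - A).1 := by
    change (1 / √(n : ℝ)) • B.1 - (1 / √(n : ℝ)) • A.1 = (1 / √(n : ℝ)) • (B.1 - A.1)
    rw [smul_sub]
  have ht : ‖(G * (((1 / √(n : ℝ)) • B).1 - ((1 / √(n : ℝ)) • A).1)).trace‖ ^ 2
      = 1 / n * ‖(G * (B - A).1).trace‖ ^ 2 := by
    rw [hs, mul_smul_comm, trace_smul, norm_smul, mul_pow, Real.norm_eq_abs, sq_abs, div_pow,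
      Real.sq_sqrt (by positivity), one_pow]
  rw [norm_scale_sub_sq] at hB
  rw [cayleyMoment_eq hn, cayleyMoment_eq hn, ← mul_sub, norm_mul, mul_pow, norm_inv,
    Complex.norm_natCast, ← ht]
  set T := (cayleyMat (isHermitian_hermMat ((1 / √(n : ℝ)) • B)) ^ k).trace
    - (cayleyMat (isHermitian_hermMat ((1 / √(n : ℝ)) • A)) ^ k).trace
  set T' := (G * (((1 / √(n : ℝ)) • B).1 - ((1 / √(n : ℝ)) • A).1)).trace
  set q := 1 / (n : ℝ) * ‖(B - A).1‖ ^ 2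
  have h1 : ‖T‖ ≤ ‖T'‖ + (4 * k ^ 2 + 2 * k) * q := by
    have := norm_add_le T' (T - T')
    rw [add_sub_cancel] at this
    linarith
  have h2 : ‖T‖ ^ 2 ≤ 2 * (‖T'‖ ^ 2 + ((4 * k ^ 2 + 2 * k) * q) ^ 2) :=
    (pow_le_pow_left₀ (norm_nonneg _) h1 2).trans add_sq_le
  calc ((n : ℝ)⁻¹) ^ 2 * ‖T‖ ^ 2
      ≤ ((n : ℝ)⁻¹) ^ 2 * (2 * (‖T'‖ ^ 2 + ((4 * k ^ 2 + 2 * k) * q) ^ 2)) := by gcongr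
    _ = _ := by ring

/-- The constant in the variance bound for truncated patterned matrices. -/
noncomputable def varianceConst (k : ℕ) (M : ℝ) : ℝ :=
  64 * M ^ 2 * (k ^ 2 + (4 * k ^ 2 + 2 * k) ^ 2 * M ^ 2)

/-- Disjoint supports handle the linear terms, and maximum times sum handles the quadratic ones.
Either way the factor η from the largest fibre survives. -/
theorem sum_norm_cayleyMoment_sub_sq_le {ι : Type*} [Fintype ι] [DecidableEq ι] {n : ℕ}
    (hn : n ≠ 0) (k : ℕ) {I : Fin n → Fin n → ι} {M : ℝ} (hM : 0 ≤ M) {η : ℝ}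
    (hη : ∀ z, ((Finset.univ.filter fun p : Fin n × Fin n => I p.1 p.2 = z).card : ℝ)
      ≤ η * (n : ℝ) ^ 2) (w v : ι → ℂ) :
    ∑ z, ‖cayleyMoment k (patternedMat I fun y => truncate M (w y))
        - cayleyMoment k (patternedMat I fun y => truncate M (Function.update w z (v z) y))‖ ^ 2
      ≤ varianceConst k M * η := by
  have hn0 : (0 : ℝ) < n := by positivity
  set A := patternedMat I fun y => truncate M (w y) with hA
  set B := fun z => patternedMat I fun y => truncate M (Function.update w z (v z) y) with hB
  obtain ⟨G, hG, h⟩ := exists_cayleyMoment_expansion hn k A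
  set D : ι → Matrix (Fin n) (Fin n) ℂ := fun z => (B z - A).1
  have hD : ∀ z i j, symmetrizedLink I i j ≠ z → D z i j = 0 := fun z i j hz => by
    change (B z).1 i j - A.1 i j = 0
    rw [sub_eq_zero]
    exact patternedMat_apply_eq I (by rw [Function.update_of_ne hz])
  have hc : ∀ z i j, ‖D z i j‖ ≤ 2 * M := fun z i j => by
    change ‖(B z).1 i j - A.1 i j‖ ≤ 2 * M
    refine (norm_sub_le _ _).trans ?_
    have h1 := (norm_patternedMat_apply_le I (fun y => truncate M (w y)) i j).trans
      (norm_truncate_le hM _)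
    have h2 := (norm_patternedMat_apply_le I
      (fun y => truncate M (Function.update w z (v z) y)) i j).trans (norm_truncate_le hM _)
    linarith
  -- Entries of `D z` are at most 2M, and symmetrizing the link at most doubles a fibre: (2M)² · 2η
  -- n².
  have hb : ∀ z, ‖D z‖ ^ 2 ≤ 8 * M ^ 2 * η * n ^ 2 := fun z => by
    refine (norm_sq_le_of_pattern hD hc z).trans ?_
    have h1 : ((Finset.univ.filter fun p : Fin n × Fin n =>
        symmetrizedLink I p.1 p.2 = z).card : ℝ) ≤ 2 * (η * n ^ 2) := by
      have h2 : ((Finset.univ.filter fun p : Fin n × Fin n =>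
          symmetrizedLink I p.1 p.2 = z).card : ℝ)
          ≤ 2 * (Finset.univ.filter fun p : Fin n × Fin n => I p.1 p.2 = z).card := by
        exact_mod_cast card_symmetrizedLink_fiber_le I z
      linarith [hη z]
    calc _ ≤ (2 * M) ^ 2 * (2 * (η * n ^ 2)) := by gcongr
      _ = _ := by ring
  have hs1 := sum_norm_trace_mul_sq_le hD G hb
  have hs2 := sum_norm_sq_le_of_pattern hD hc
  rw [Fintype.card_fin] at hs2
  -- The sign of η is not assumed; nonnegativity of the bound is read off from some key, which
  -- exists since n ≠ 0.
  rcases isEmpty_or_nonempty ι with hι | ⟨⟨z₀⟩⟩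
  · have := I ⟨0, Nat.pos_of_ne_zero hn⟩ ⟨0, Nat.pos_of_ne_zero hn⟩
    exact isEmptyElim this
  have hb0 : 0 ≤ 8 * M ^ 2 * η * n ^ 2 := (sq_nonneg _).trans (hb z₀)
  have hs3 : ∑ z, (‖D z‖ ^ 2) ^ 2 ≤ 8 * M ^ 2 * η * n ^ 2 * ((2 * M) ^ 2 * n ^ 2) := by
    calc ∑ z, (‖D z‖ ^ 2) ^ 2 ≤ ∑ z, 8 * M ^ 2 * η * n ^ 2 * ‖D z‖ ^ 2 :=
          Finset.sum_le_sum fun z _ => by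
            rw [sq (‖D z‖ ^ 2)]
            exact mul_le_mul_of_nonneg_right (hb z) (sq_nonneg _)
      _ ≤ _ := by
          rw [← Finset.mul_sum]
          exact mul_le_mul_of_nonneg_left hs2 hb0
  calc _ ≤ ∑ z, 2 / (n : ℝ) ^ 2 * (1 / n * ‖(G * D z).trace‖ ^ 2
          + (4 * k ^ 2 + 2 * k) ^ 2 * (1 / n * ‖D z‖ ^ 2) ^ 2) :=
        Finset.sum_le_sum fun z _ => by rw [norm_sub_rev]; exact h (B z)
    _ = 2 / (n : ℝ) ^ 2 * (1 / n * ∑ z, ‖(G * D z).trace‖ ^ 2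
          + (4 * k ^ 2 + 2 * k) ^ 2 * ((1 / n) ^ 2 * ∑ z, (‖D z‖ ^ 2) ^ 2)) := by
        simp only [mul_pow, Finset.mul_sum, ← Finset.sum_add_distrib]
    _ ≤ 2 / (n : ℝ) ^ 2 * (1 / n * ((2 * k) ^ 2 * n * (8 * M ^ 2 * η * n ^ 2))
          + (4 * k ^ 2 + 2 * k) ^ 2 * ((1 / n) ^ 2
            * (8 * M ^ 2 * η * n ^ 2 * ((2 * M) ^ 2 * n ^ 2)))) := by
        gcongr
        exact hs1.trans (mul_le_mul_of_nonneg_right hG hb0)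
    _ = _ := by
        rw [varianceConst]
        field_simp
        ring

end PatternedMatrices

/-! ### Concentration of the Cayley moments. -/

section MomentConcentration

open Matrix
open scoped Matrix.Norms.Frobenius

variable {Ω : Type*} [MeasurableSpace Ω] {P : Measure Ω}

theorem measurable_smul_hermMat_apply {n : ℕ} {A : Ω → HermMat n}
    (hA : ∀ i j, Measurable fun ω => (A ω).1 i j) (c : ℝ) (i j : Fin n) :
    Measurable fun ω => (c • A ω).1 i j := by
  have h : ∀ ω, (c • A ω).1 i j = c • (A ω).1 i j := fun ω => rfl
  simp_rw [h]
  exact (hA i j).const_smul c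

theorem measurable_cayleyMoment {n : ℕ} (k : ℕ) {A : Ω → HermMat n}
    (hA : ∀ i j, Measurable fun ω => (A ω).1 i j) :
    Measurable fun ω => cayleyMoment k (A ω) :=
  measurable_integral_of_measurable
    (measurable_coe_esd (measurable_smul_hermMat_apply hA (1 / √(n : ℝ))))
    (continuous_cayley.measurable.pow_const k)

theorem integral_norm_truncated_sub_sq_le {κ : Type*} [DecidableEq κ] [IsProbabilityMeasure P]
    {Z : κ → Ω → ℂ}
    (hZ : ∀ z, Measurable (Z z)) (hind : iIndepFun Z P) {n : ℕ} (hn : n ≠ 0) (k : ℕ)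
    (I : Fin n → Fin n → κ) {M : ℝ} (hM : 0 ≤ M) {η : ℝ}
    (hη : ∀ z, ((Finset.univ.filter fun p : Fin n × Fin n => I p.1 p.2 = z).card : ℝ)
      ≤ η * (n : ℝ) ^ 2) :
    ∫ ω, ‖cayleyMoment k (patternedMat I fun y => truncate M (Z y ω))
        - ∫ ω', cayleyMoment k (patternedMat I fun y => truncate M (Z y ω')) ∂P‖ ^ 2 ∂P
      ≤ varianceConst k M * η := by
  -- Only finitely many variables enter for fixed n; restricting to them gives a finite product law,
  -- as Efron–Stein requires.
  let ι := Set.range fun p : Fin n × Fin n => I p.1 p.2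
  have : Fintype ι := Fintype.ofFinite ι
  let I' : Fin n → Fin n → ι := fun i j => ⟨I i j, ⟨(i, j), rfl⟩⟩
  let F : (ι → ℂ) → ℂ := fun w => cayleyMoment k (patternedMat I' fun y => truncate M (w y))
  have hF : Measurable F := by
    refine measurable_cayleyMoment k fun i j => ?_
    exact (measurable_patternedMat_apply I' i j).comp
      (measurable_pi_lambda _ fun y => (measurable_truncate M).comp (measurable_pi_apply y))
  let W : Ω → ι → ℂ := fun ω y => Z y ω
  have hW : Measurable W := measurable_pi_lambda _ fun y => hZ y
  have hgF : ∀ ω, cayleyMoment k (patternedMat I fun y => truncate M (Z y ω)) = F (W ω) :=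
    fun ω => rfl
  have hpi : P.map W = Measure.pi fun y : ι => P.map (Z y) :=
    (hind.precomp Subtype.val_injective).map_fun_eq_pi_map fun y => (hZ y).aemeasurable
  have hprob : ∀ y : ι, IsProbabilityMeasure (P.map (Z y)) := fun y =>
    Measure.isProbabilityMeasure_map (hZ y).aemeasurable
  have hη' : ∀ z : ι, ((Finset.univ.filter fun p : Fin n × Fin n => I' p.1 p.2 = z).card : ℝ)
      ≤ η * (n : ℝ) ^ 2 := fun z => by
    refine le_trans (le_of_eq ?_) (hη z)
    simp only [I', Subtype.ext_iff]
  have h := integral_norm_sub_integral_sq_le (μ := fun y : ι => P.map (Z y)) hF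
    (fun w => norm_cayleyMoment_le k _)
    (fun w v => sum_norm_cayleyMoment_sub_sq_le hn k hM hη' w v)
  rw [← hpi, integral_map hW.aemeasurable hF.aestronglyMeasurable,
    integral_map hW.aemeasurable (by fun_prop)] at h
  exact h

open scoped Classical in
/-- The sum `n⁻² ∑ |A i j|² 1{|A i j| > M}` in the Lindeberg condition. -/
noncomputable def tailSum {n : ℕ} (M : ℝ) (A : HermMat n) : ℝ :=
  1 / (n : ℝ) ^ 2 * ∑ i, ∑ j, if M < ‖A.1 i j‖ then ‖A.1 i j‖ ^ 2 else 0

theorem measurable_tailSum {n : ℕ} (M : ℝ) {A : Ω → HermMat n}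
    (hA : ∀ i j, Measurable fun ω => (A ω).1 i j) : Measurable fun ω => tailSum M (A ω) := by
  unfold tailSum
  refine Measurable.const_mul ?_ _
  refine Finset.measurable_sum _ fun i _ => Finset.measurable_sum _ fun j _ => ?_
  have := hA i j
  exact Measurable.ite (measurableSet_lt (by fun_prop) (by fun_prop)) (by fun_prop)
    measurable_const

theorem LindebergCondition.exists_eventually_lt {X : (n : ℕ) → Ω → HermMat n}
    (h : LindebergCondition P X) {ε : ℝ} (hε : 0 < ε) {δ : ℝ≥0∞} (hδ : 0 < δ) :
    ∃ M, 0 ≤ M ∧ ∀ᶠ n : ℕ in atTop, P {ω | ε < tailSum M (X n ω)} < δ := by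
  have h1 := (h ε hε).eventually (gt_mem_nhds hδ)
  obtain ⟨M, hM, hM0⟩ := (h1.and (eventually_ge_atTop 0)).exists
  exact ⟨M, hM0, eventually_lt_of_limsup_lt hM⟩

theorem norm_sq_le_tailSum {n : ℕ} (hn : n ≠ 0) (M : ℝ) (A : HermMat n) :
    1 / (n : ℝ) ^ 2 * ‖A.1‖ ^ 2 ≤ M ^ 2 + tailSum M A := by
  classical
  have hn0 : (n : ℝ) ≠ 0 := by exact_mod_cast hn
  have h : ‖A.1‖ ^ 2 ≤ n ^ 2 * M ^ 2
      + ∑ i, ∑ j, if M < ‖A.1 i j‖ then ‖A.1 i j‖ ^ 2 else 0 := by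
    have hc : (n : ℝ) ^ 2 * M ^ 2 = ∑ _i : Fin n, ∑ _j : Fin n, M ^ 2 := by
      simp
      ring
    rw [frobenius_norm_sq, hc, ← Finset.sum_add_distrib]
    refine Finset.sum_le_sum fun i _ => ?_
    rw [← Finset.sum_add_distrib]
    refine Finset.sum_le_sum fun j _ => ?_
    split_ifs with h
    · linarith [sq_nonneg M]
    · rw [add_zero]
      exact pow_le_pow_left₀ (norm_nonneg _) (not_lt.1 h) 2
  calc _ ≤ 1 / (n : ℝ) ^ 2 * (n ^ 2 * M ^ 2
      + ∑ i, ∑ j, if M < ‖A.1 i j‖ then ‖A.1 i j‖ ^ 2 else 0) := by gcongr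
    _ = _ := by
      rw [tailSum, mul_add, ← mul_assoc, one_div_mul_cancel (pow_ne_zero 2 hn0), one_mul]

section patterned

variable {d : ℕ} {I : LinkFamily d} {Z : (Fin d → ℤ) → Ω → ℂ} {X : (n : ℕ) → Ω → HermMat n}

omit [MeasurableSpace Ω] in
theorem IsPatterned.apply_of_lt (hX : IsPatterned I Z X) {n : ℕ} (ω : Ω) {i j : Fin n}
    (h : j < i) : (X n ω).1 i j = star (Z (I n j i) ω) := by
  rw [← hX n ω j i h.le]
  exact ((isHermitian_hermMat (X n ω)).apply i j).symm

-- Hermitian symmetry forces the diagonal variables to be real at every ω, so taking real parts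
-- there changes nothing.
omit [MeasurableSpace Ω] in
theorem IsPatterned.eq_patternedMat (hX : IsPatterned I Z X) (n : ℕ) (ω : Ω) :
    X n ω = patternedMat (I n) fun y => Z y ω := by
  ext i j
  rcases lt_trichotomy i j with h | rfl | h
  · rw [hX n ω i j h.le]
    simp [patternedMat, h]
  · have h1 := (isHermitian_hermMat (X n ω)).apply i i
    rw [hX n ω i i le_rfl] at h1 ⊢
    simpa [patternedMat] using (Complex.conj_eq_iff_re.1 h1).symm
  · rw [hX.apply_of_lt ω h]
    simp [patternedMat, h, h.not_gt]

omit [MeasurableSpace Ω] in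
theorem IsPatterned.norm_apply (hX : IsPatterned I Z X) (n : ℕ) (ω : Ω) (i j : Fin n) :
    ‖(X n ω).1 i j‖ = ‖Z (symmetrizedLink (I n) i j) ω‖ := by
  rcases lt_trichotomy i j with h | rfl | h
  · rw [hX n ω i j h.le, symmetrizedLink, if_pos h]
  · rw [hX n ω i i le_rfl, symmetrizedLink, if_neg (lt_irrefl _)]
  · rw [hX.apply_of_lt ω h, symmetrizedLink, if_neg h.not_gt, norm_star]

theorem IsPatterned.measurable_apply (hX : IsPatterned I Z X) (hZ : ∀ z, Measurable (Z z))
    (n : ℕ) (i j : Fin n) : Measurable fun ω => (X n ω).1 i j := by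
  simp_rw [hX.eq_patternedMat]
  exact (measurable_patternedMat_apply (I n) i j).comp (measurable_pi_lambda _ hZ)

omit [MeasurableSpace Ω] in
theorem IsPatterned.norm_sub_truncated_le (hX : IsPatterned I Z X) (n : ℕ) (ω : Ω) (M : ℝ) :
    1 / (n : ℝ) ^ 2 * ‖(X n ω - patternedMat (I n) fun y => truncate M (Z y ω)).1‖ ^ 2
      ≤ tailSum M (X n ω) := by
  rw [tailSum, frobenius_norm_sq]
  gcongr with i _ j _
  rw [hX.norm_apply n ω i j, hX.eq_patternedMat n ω, patternedMat_sub]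
  refine (pow_le_pow_left₀ (norm_nonneg _) (norm_patternedMat_apply_le _ _ i j) 2).trans ?_
  simp only [Pi.sub_apply, truncate]
  split_ifs with h1 h2 h2
  · exact absurd h1 h2.not_ge
  · simp
  · simp
  · exact absurd (not_lt.1 h2) h1

end patterned

theorem integral_norm_sub_integral_le [IsProbabilityMeasure P] {f g : Ω → ℂ}
    (hf : Integrable f P) (hg : Integrable g P) :
    ∫ ω, ‖f ω - ∫ ω', f ω' ∂P‖ ∂P
      ≤ 2 * ∫ ω, ‖f ω - g ω‖ ∂P + ∫ ω, ‖g ω - ∫ ω', g ω' ∂P‖ ∂P := by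
  set a := ∫ ω', f ω' ∂P with ha
  set b := ∫ ω', g ω' ∂P with hb
  have hab : ‖b - a‖ ≤ ∫ ω, ‖f ω - g ω‖ ∂P := by
    rw [norm_sub_rev, ha, hb, ← integral_sub hf hg]
    exact norm_integral_le_integral_norm _
  have h1 : Integrable (fun ω => ‖f ω - g ω‖) P := (hf.sub hg).norm
  have h2 : Integrable (fun ω => ‖g ω - b‖) P := (hg.sub (integrable_const b)).norm
  calc ∫ ω, ‖f ω - a‖ ∂P ≤ ∫ ω, (‖f ω - g ω‖ + ‖g ω - b‖ + ‖b - a‖) ∂P := by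
        refine integral_mono (hf.sub (integrable_const a)).norm
          ((h1.add h2).add (integrable_const _)) fun ω => ?_
        have h3 : f ω - a = (f ω - g ω) + (g ω - b) + (b - a) := by ring
        dsimp only
        rw [h3]
        exact norm_add₃_le
    _ = ∫ ω, ‖f ω - g ω‖ ∂P + ∫ ω, ‖g ω - b‖ ∂P + ‖b - a‖ := by
        rw [integral_add (f := fun ω => ‖f ω - g ω‖ + ‖g ω - b‖) (h1.add h2) (integrable_const _),
          integral_add h1 h2]
        simp
    _ ≤ _ := by linarith

theorem integral_le_of_le_off {f : Ω → ℝ} [IsProbabilityMeasure P] (hf : Integrable f P)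
    {s : Set Ω} (hs : MeasurableSet s) {a b : ℝ} (ha : 0 ≤ a) (hfs : ∀ ω ∉ s, f ω ≤ a)
    (hb : ∀ ω, f ω ≤ b) : ∫ ω, f ω ∂P ≤ a + b * P.real s := by
  have h : ∀ ω, f ω ≤ a + s.indicator (fun _ => b) ω := fun ω => by
    by_cases hω : ω ∈ s
    · rw [Set.indicator_of_mem hω]
      linarith [hb ω]
    · rw [Set.indicator_of_notMem hω, add_zero]
      exact hfs ω hω
  have hi : Integrable (s.indicator fun _ => b) P := (integrable_const b).indicator hs
  refine (integral_mono hf ((integrable_const a).add hi) h).trans (le_of_eq ?_)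
  have h2 := integral_add (integrable_const (μ := P) a) hi
  rw [integral_indicator_const b hs] at h2
  simpa [mul_comm] using h2

/-- Integrate the pointwise bound t ≤ δ + t²/δ. -/
theorem integral_norm_le_of_integral_norm_sq_le [IsProbabilityMeasure P] {f : Ω → ℂ}
    (hf : Integrable f P) (hf2 : Integrable (fun ω => ‖f ω‖ ^ 2) P) {c δ : ℝ} (hδ : 0 < δ)
    (hc : ∫ ω, ‖f ω‖ ^ 2 ∂P ≤ c) : ∫ ω, ‖f ω‖ ∂P ≤ δ + c / δ := by
  have h : ∀ ω, ‖f ω‖ ≤ δ + δ⁻¹ * ‖f ω‖ ^ 2 := fun ω => by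
    have h1 : δ * ‖f ω‖ ≤ δ ^ 2 + ‖f ω‖ ^ 2 := by
      nlinarith [sq_nonneg (δ - ‖f ω‖), sq_nonneg δ, sq_nonneg ‖f ω‖]
    calc ‖f ω‖ = δ⁻¹ * (δ * ‖f ω‖) := by field_simp
      _ ≤ δ⁻¹ * (δ ^ 2 + ‖f ω‖ ^ 2) := by gcongr
      _ = _ := by field_simp
  calc ∫ ω, ‖f ω‖ ∂P ≤ ∫ ω, (δ + δ⁻¹ * ‖f ω‖ ^ 2) ∂P :=
        integral_mono hf.norm ((integrable_const δ).add (hf2.const_mul _)) h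
    _ = δ + δ⁻¹ * ∫ ω, ‖f ω‖ ^ 2 ∂P := by
        rw [integral_add (integrable_const δ) (hf2.const_mul _), integral_const_mul]
        simp
    _ ≤ δ + δ⁻¹ * c := by gcongr
    _ = _ := by ring

/-- The order of choices matters: M comes from condition L, and only then is η chosen small relative
to the variance constant of M. The truncation error costs at most 2(ε/8 + ε/16) and the fluctuation
ε/4, in total 5ε/8. -/
theorem tendsto_integral_norm_cayleyMoment_sub [IsProbabilityMeasure P] {d : ℕ}
    {I : LinkFamily d} {Z : (Fin d → ℤ) → Ω → ℂ} {X : (n : ℕ) → Ω → HermMat n}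
    (hZ : ∀ z, Measurable (Z z)) (hind : iIndepFun Z P) (hX : IsPatterned I Z X)
    (hL : LindebergCondition P X) (hI : I.SmallFibers) (k : ℕ) :
    Tendsto (fun n => ∫ ω, ‖cayleyMoment k (X n ω) - ∫ ω', cayleyMoment k (X n ω') ∂P‖ ∂P)
      atTop (𝓝 0) := by
  rw [Metric.tendsto_nhds]
  intro ε hε
  set γ : ℝ := (ε / (16 * (k + 1))) ^ 2 with hγ
  have hγ0 : 0 < γ := by positivity
  have hγ1 : 2 * k * √γ ≤ ε / 8 := by
    rw [hγ, Real.sqrt_sq (by positivity)]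
    have : 2 * k * (ε / (16 * (k + 1))) = ε / 8 * (k / (k + 1)) := by
      field_simp
      ring
    rw [this]
    refine mul_le_of_le_one_right (by positivity) ?_
    rw [div_le_one (by positivity)]
    linarith
  obtain ⟨M, hM, hMn⟩ := hL.exists_eventually_lt hγ0
    (δ := ENNReal.ofReal (ε / 32)) (by simpa using by positivity)
  set C := varianceConst k M with hC
  have hC0 : 0 ≤ C := by
    rw [hC, varianceConst]
    positivity
  -- Chosen so that C η ≤ (ε/8)²; the +1 covers C = 0.
  set η : ℝ := (ε / 8) ^ 2 / (C + 1) with hη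
  have hη0 : 0 < η := by positivity
  filter_upwards [hMn, hI η hη0, eventually_ne_atTop 0] with n hn1 hn2 hn
  set f : Ω → ℂ := fun ω => cayleyMoment k (X n ω) with hf
  set g : Ω → ℂ := fun ω => cayleyMoment k (patternedMat (I n) fun y => truncate M (Z y ω))
    with hg
  have hXm := hX.measurable_apply hZ n
  have hfm : Measurable f := measurable_cayleyMoment k hXm
  have hgm : Measurable g := measurable_cayleyMoment k fun i j =>
    (measurable_patternedMat_apply (I n) i j).comp
      (measurable_pi_lambda _ fun y => (measurable_truncate M).comp (hZ y))
  have hfi : Integrable f P := integrable_of_measurable_of_bound hfm 1 fun ω =>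
    norm_cayleyMoment_le k _
  have hgi : Integrable g P := integrable_of_measurable_of_bound hgm 1 fun ω =>
    norm_cayleyMoment_le k _
  set b := ∫ ω, g ω ∂P with hb
  have hb1 : ‖b‖ ≤ 1 := by
    refine (norm_integral_le_of_norm_le_const (C := 1) (ae_of_all _ fun ω => ?_)).trans ?_
    · exact norm_cayleyMoment_le k _
    · simp
  have hvar : ∫ ω, ‖g ω - b‖ ^ 2 ∂P ≤ C * η :=
    integral_norm_truncated_sub_sq_le hZ hind hn k (I n) hM hn2
  have h1 : ∫ ω, ‖g ω - b‖ ∂P ≤ ε / 8 + C * η / (ε / 8) := by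
    refine integral_norm_le_of_integral_norm_sq_le (hgi.sub (integrable_const b)) ?_
      (by positivity) hvar
    refine integrable_of_measurable_of_bound (by fun_prop) (2 ^ 2) fun ω => ?_
    rw [norm_pow, norm_norm]
    refine pow_le_pow_left₀ (norm_nonneg _) ((norm_sub_le _ _).trans ?_) 2
    linarith [show ‖g ω‖ ≤ 1 from norm_cayleyMoment_le k _]
  have h2 : C * η / (ε / 8) ≤ ε / 8 := by
    rw [div_le_iff₀ (by positivity), hη, ← sq]
    have : C * ((ε / 8) ^ 2 / (C + 1)) = (ε / 8) ^ 2 * (C / (C + 1)) := by ring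
    rw [this]
    refine mul_le_of_le_one_right (by positivity) ?_
    rw [div_le_one (by positivity)]
    linarith
  have h3 : ∫ ω, ‖f ω - g ω‖ ∂P
      ≤ 2 * k * √γ + 2 * P.real {ω | γ < tailSum M (X n ω)} := by
    refine integral_le_of_le_off (hfi.sub hgi).norm
      (measurableSet_lt measurable_const (measurable_tailSum M hXm)) (by positivity)
      (fun ω hω => ?_) (fun ω => ?_)
    · refine (norm_cayleyMoment_sub_le hn k _ _).trans ?_
      gcongr
      exact (hX.norm_sub_truncated_le n ω M).trans (not_lt.1 hω)
    · refine (norm_sub_le _ _).trans ?_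
      linarith [show ‖g ω‖ ≤ 1 from norm_cayleyMoment_le k _,
        show ‖f ω‖ ≤ 1 from norm_cayleyMoment_le k _]
  have h4 : P.real {ω | γ < tailSum M (X n ω)} ≤ ε / 32 := by
    rw [measureReal_def]
    exact ENNReal.toReal_le_of_le_ofReal (by positivity) hn1.le
  have h5 := integral_norm_sub_integral_le hfi hgi
  rw [Real.dist_eq, sub_zero, abs_of_nonneg (integral_nonneg fun ω => norm_nonneg _)]
  change ∫ ω, ‖f ω - ∫ ω', f ω' ∂P‖ ∂P < ε
  linarith

end MomentConcentration

/-! ### Weak convergence from Cayley moments. -/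

section WeakConvergence

open BoundedContinuousFunction

/-- The Cayley transform as a bounded continuous function. -/
noncomputable def cayleyBCF : ℝ →ᵇ ℂ :=
  BoundedContinuousFunction.ofNormedAddCommGroup cayley continuous_cayley 1
    fun x => (norm_cayley x).le

theorem cayleyBCF_pow_apply (k : ℕ) (x : ℝ) : (cayleyBCF ^ k) x = cayley x ^ k := by
  rw [BoundedContinuousFunction.coe_pow]
  rfl

theorem star_cayleyBCF_mul : star cayleyBCF * cayleyBCF = 1 := by
  ext x
  exact star_cayley_mul_cayley x

/-- On the unit circle conjugation is inversion, so mixed products cancel to a single power or its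
conjugate. -/
theorem exists_pow_or_star_pow_of_mem_closure {f : ℝ →ᵇ ℂ}
    (hf : f ∈ Submonoid.closure ({cayleyBCF} ∪ star {cayleyBCF} : Set (ℝ →ᵇ ℂ))) :
    ∃ k : ℕ, f = cayleyBCF ^ k ∨ f = star (cayleyBCF ^ k) := by
  rw [Set.star_singleton, Set.singleton_union, Submonoid.mem_closure_pair] at hf
  obtain ⟨a, b, rfl⟩ := hf
  have h1 : ∀ c : ℕ, cayleyBCF ^ c * star cayleyBCF ^ c = 1 := fun c => by
    rw [← mul_pow, mul_comm, star_cayleyBCF_mul, one_pow]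
  rcases le_total b a with h | h
  · refine ⟨a - b, .inl ?_⟩
    obtain ⟨c, rfl⟩ := Nat.exists_eq_add_of_le' h
    rw [pow_add, mul_assoc, h1, mul_one, Nat.add_sub_cancel]
  · refine ⟨b - a, .inr ?_⟩
    obtain ⟨c, rfl⟩ := Nat.exists_eq_add_of_le h
    rw [pow_add, ← mul_assoc, h1, one_mul, Nat.add_sub_cancel_left, star_pow]

theorem integral_eq_of_mem_adjoin_cayleyBCF {μ ν : Measure ℝ} [IsFiniteMeasure μ]
    [IsFiniteMeasure ν] (h : ∀ k : ℕ, ∫ x, cayley x ^ k ∂μ = ∫ x, cayley x ^ k ∂ν)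
    {f : ℝ →ᵇ ℂ} (hf : f ∈ StarAlgebra.adjoin ℂ {cayleyBCF}) : ∫ x, f x ∂μ = ∫ x, f x ∂ν := by
  have hf' : f ∈ Submodule.span ℂ
      (Submonoid.closure ({cayleyBCF} ∪ star {cayleyBCF} : Set (ℝ →ᵇ ℂ)) : Set (ℝ →ᵇ ℂ)) := by
    rw [← StarAlgebra.adjoin_eq_span]
    exact hf
  clear hf
  induction hf' using Submodule.span_induction with
  | mem g hg =>
    obtain ⟨k, rfl | rfl⟩ := exists_pow_or_star_pow_of_mem_closure hg
    · simpa only [cayleyBCF_pow_apply] using h k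
    · have hs : ∀ x, star (cayleyBCF ^ k) x = (starRingEnd ℂ) (cayley x ^ k) := fun x => by
        rw [← cayleyBCF_pow_apply]
        rfl
      simp_rw [hs]
      rw [integral_conj, integral_conj, h k]
  | zero => simp
  | add g₁ g₂ _ _ h₁ h₂ =>
    simp only [BoundedContinuousFunction.coe_add, Pi.add_apply]
    rw [integral_add (g₁.integrable μ) (g₂.integrable μ),
      integral_add (g₁.integrable ν) (g₂.integrable ν), h₁, h₂]
  | smul c g _ hg =>
    simp only [BoundedContinuousFunction.coe_smul]
    rw [integral_smul, integral_smul, hg]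

/-- The star algebra generated by the Cayley transform separates points, since that transform is
injective; such an algebra determines a measure. -/
theorem probabilityMeasure_ext_of_cayley {μ ν : ProbabilityMeasure ℝ}
    (h : ∀ k : ℕ, ∫ x, cayley x ^ k ∂(μ : Measure ℝ) = ∫ x, cayley x ^ k ∂(ν : Measure ℝ)) :
    μ = ν := by
  have h1 : ∀ g ∈ StarAlgebra.adjoin ℂ {cayleyBCF},
      ∫ x, g x ∂(μ : Measure ℝ) = ∫ x, g x ∂(ν : Measure ℝ) :=
    fun g hg => integral_eq_of_mem_adjoin_cayleyBCF h hg
  refine Subtype.ext (ext_of_forall_mem_subalgebra_integral_eq_of_polish (P := (μ : Measure ℝ))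
    (P' := (ν : Measure ℝ)) (A := StarAlgebra.adjoin ℂ {cayleyBCF}) ?_ h1)
  intro x y hxy
  refine ⟨cayley, ⟨(cayleyBCF.toContinuousMap), ⟨cayleyBCF, ?_, rfl⟩, rfl⟩,
    fun h => hxy (cayley_injective h)⟩
  exact StarAlgebra.subset_adjoin ℂ _ rfl

theorem tendsto_dist_of_metrizes {ι : Type*} {l : Filter ι} (d : MetricSpace (ProbabilityMeasure ℝ))
    (hd : d.toPseudoMetricSpace.toUniformSpace.toTopologicalSpace =
      ProbabilityMeasure.instTopologicalSpace)
    {u : ι → ProbabilityMeasure ℝ} {a : ProbabilityMeasure ℝ} (h : Tendsto u l (𝓝 a)) :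
    Tendsto (fun i => d.dist (u i) a) l (𝓝 0) := by
  rw [← hd] at h
  exact (@tendsto_iff_dist_tendsto_zero _ _ d.toPseudoMetricSpace _ _ _).1 h

/-- On a tight set of probability measures, two measures with finitely many close Cayley moments
are close. -/
theorem exists_dist_lt_of_cayley_close (d : MetricSpace (ProbabilityMeasure ℝ))
    (hd : d.toPseudoMetricSpace.toUniformSpace.toTopologicalSpace =
      ProbabilityMeasure.instTopologicalSpace)
    {S : Set (Measure ℝ)} (hS : IsTightMeasureSet S) {ε : ℝ} (hε : 0 < ε) :
    ∃ K : ℕ, ∃ δ : ℝ, 0 < δ ∧ ∀ μ ν : ProbabilityMeasure ℝ,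
      (μ : Measure ℝ) ∈ S → (ν : Measure ℝ) ∈ S →
      (∀ k < K, ‖∫ x, cayley x ^ k ∂(μ : Measure ℝ) - ∫ x, cayley x ^ k ∂(ν : Measure ℝ)‖ < δ) →
      d.dist μ ν < ε := by
  by_contra! hcon
  -- The j-th counterexample pair agrees to within 1/(j+1) in the first j moments, yet stays ε
  -- apart.
  choose μ ν hμ hν hclose hfar using fun j : ℕ =>
    hcon j (1 / ((j : ℝ) + 1)) (by positivity)
  let T : Set (ProbabilityMeasure ℝ) := {ρ | (ρ : Measure ℝ) ∈ S}
  have hT : IsCompact (closure T) := by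
    refine isCompact_closure_of_isTightMeasureSet (hS.subset ?_)
    rintro _ ⟨ρ, hρ, rfl⟩
    exact hρ
  -- By compactness both sequences converge along one ultrafilter, so no subsequences are extracted.
  -- The two limits share all Cayley moments and therefore coincide.
  let U : Ultrafilter ℕ := Ultrafilter.of atTop
  have hU : (U : Filter ℕ) ≤ atTop := Ultrafilter.of_le _
  have hlim : ∀ ρ : ℕ → ProbabilityMeasure ℝ, (∀ j, (ρ j : Measure ℝ) ∈ S) →
      ∃ ρ₀, Tendsto ρ U (𝓝 ρ₀) := fun ρ hρ => by
    obtain ⟨ρ₀, -, h⟩ := hT.ultrafilter_le_nhds (U.map ρ) (by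
      rw [le_principal_iff]
      exact Filter.mem_map.2 (Filter.univ_mem' fun j => subset_closure (hρ j)))
    exact ⟨ρ₀, h⟩
  obtain ⟨μ₀, hμ₀⟩ := hlim μ hμ
  obtain ⟨ν₀, hν₀⟩ := hlim ν hν
  have hint : ∀ (ρ : ℕ → ProbabilityMeasure ℝ) (ρ₀ : ProbabilityMeasure ℝ) (k : ℕ),
      Tendsto ρ U (𝓝 ρ₀) → Tendsto (fun j => ∫ x, cayley x ^ k ∂(ρ j : Measure ℝ)) U
        (𝓝 (∫ x, cayley x ^ k ∂(ρ₀ : Measure ℝ))) := fun ρ ρ₀ k h => by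
    have := (ProbabilityMeasure.tendsto_iff_forall_integral_rclike_tendsto ℂ).1 h (cayleyBCF ^ k)
    simpa only [cayleyBCF_pow_apply] using this
  have heq : μ₀ = ν₀ := by
    refine probabilityMeasure_ext_of_cayley fun k => ?_
    have h1 := (hint μ μ₀ k hμ₀).sub (hint ν ν₀ k hν₀)
    have h2 : Tendsto (fun j => ∫ x, cayley x ^ k ∂(μ j : Measure ℝ)
        - ∫ x, cayley x ^ k ∂(ν j : Measure ℝ)) U (𝓝 0) := by
      refine squeeze_zero_norm' ?_
        ((tendsto_one_div_add_atTop_nhds_zero_nat (𝕜 := ℝ)).mono_left hU)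
      filter_upwards [hU (eventually_gt_atTop k)] with j hj
      exact (hclose j k hj).le
    exact sub_eq_zero.1 (tendsto_nhds_unique h1 h2)
  subst heq
  have h3 := (tendsto_dist_of_metrizes d hd hμ₀).add (tendsto_dist_of_metrizes d hd hν₀)
  rw [add_zero] at h3
  obtain ⟨j, hj⟩ := (h3.eventually (gt_mem_nhds hε)).exists
  have htri := d.dist_triangle (μ j) μ₀ (ν j)
  rw [d.dist_comm μ₀ (ν j)] at htri
  exact absurd (htri.trans_lt hj) (hfar j).not_gt

theorem measure_norm_gt_le (ν : Measure ℝ) {r : ℝ} (hr : 0 < r) {B : ℝ}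
    (h : ∫⁻ x, ENNReal.ofReal (x ^ 2) ∂ν ≤ ENNReal.ofReal B) :
    ν {x | r < ‖x‖} ≤ ENNReal.ofReal (B / r ^ 2) := by
  have h1 := mul_meas_ge_le_lintegral (μ := ν) (f := fun x : ℝ => ENNReal.ofReal (x ^ 2))
    (by fun_prop) (ENNReal.ofReal (r ^ 2))
  rw [ENNReal.ofReal_div_of_pos (by positivity), ENNReal.le_div_iff_mul_le (by simp [hr.ne'])
    (by simp), mul_comm]
  refine le_trans ?_ (h1.trans h)
  gcongr with x
  intro hx
  refine ENNReal.ofReal_le_ofReal ?_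
  rw [← sq_abs x]
  exact pow_le_pow_left₀ hr.le (le_of_lt hx) 2

theorem tendsto_ofReal_div_sq (B : ℝ) :
    Tendsto (fun r : ℝ => ENNReal.ofReal (B / r ^ 2)) atTop (𝓝 0) := by
  rw [← ENNReal.ofReal_zero]
  refine ENNReal.tendsto_ofReal ?_
  exact Tendsto.div_atTop tendsto_const_nhds (tendsto_pow_atTop two_ne_zero)

theorem isTightMeasureSet_lintegral_sq_le (B : ℝ) :
    IsTightMeasureSet {ν : Measure ℝ | ∫⁻ x, ENNReal.ofReal (x ^ 2) ∂ν ≤ ENNReal.ofReal B} := by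
  refine isTightMeasureSet_of_tendsto_measure_norm_gt ?_
  refine tendsto_of_tendsto_of_tendsto_of_le_of_le' tendsto_const_nhds (tendsto_ofReal_div_sq B)
    (.of_forall fun _ => zero_le) ?_
  filter_upwards [eventually_gt_atTop 0] with r hr
  exact iSup₂_le fun ν hν => measure_norm_gt_le ν hr hν

end WeakConvergence

/-! ### Tightness and concentration around the mean measure. -/

section Concentration

open Matrix
open scoped Matrix.Norms.Frobenius

variable {Ω : Type*} [MeasurableSpace Ω] {P : Measure Ω}

theorem lintegral_sq_esd_le {n : ℕ} (hn : n ≠ 0) (M : ℝ) (A : HermMat n) :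
    ∫⁻ x, ENNReal.ofReal (x ^ 2) ∂(esd ((1 / √(n : ℝ)) • A) : Measure ℝ)
      ≤ ENNReal.ofReal (M ^ 2 + tailSum M A) := by
  have hn0 : (0 : ℝ) < n := by positivity
  rw [coe_esd hn, lintegral_sq_esdMeasure, ← ENNReal.ofReal_natCast,
    ← ENNReal.ofReal_inv_of_pos hn0, ← ENNReal.ofReal_mul (by positivity)]
  refine ENNReal.ofReal_le_ofReal (le_trans (le_of_eq ?_) (norm_sq_le_tailSum hn M A))
  have h := norm_scale_sub_sq (0 : HermMat n) A
  rw [smul_zero, sub_zero] at h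
  have h0 : ((1 / √(n : ℝ)) • A).1 - (0 : HermMat n).1 = ((1 / √(n : ℝ)) • A).1 := sub_zero _
  rw [h0] at h
  rw [h]
  ring

/-- Where the tail sum is at most 1, the second moment is at most M² + 1 and Chebyshev applies. The
remaining event adds at most its small probability to the averaged tail. -/
theorem isTightMeasureSet_range_mean [IsProbabilityMeasure P] {X : (n : ℕ) → Ω → HermMat n}
    (hXm : ∀ n i j, Measurable fun ω => (X n ω).1 i j) (hL : LindebergCondition P X)
    {EL : ℕ → ProbabilityMeasure ℝ}
    (hEL : ∀ n : ℕ, IsMeanMeasure P (fun ω => esd ((1 / √(n : ℝ)) • X n ω)) (EL n)) :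
    IsTightMeasureSet (Set.range fun n => (EL n : Measure ℝ)) := by
  refine isTightMeasureSet_range_of_tendsto_limsup_measure_norm_gt ?_
  rw [ENNReal.tendsto_nhds_zero]
  intro ε hε
  obtain ⟨M, -, hMn⟩ := hL.exists_eventually_lt one_pos (ENNReal.half_pos hε.ne')
  have h1 := (ENNReal.tendsto_nhds_zero.1 (tendsto_ofReal_div_sq (M ^ 2 + 1))) _
    (ENNReal.half_pos hε.ne')
  filter_upwards [h1, eventually_gt_atTop 0] with r hr hr0
  refine limsup_le_of_le (by isBoundedDefault) ?_
  filter_upwards [hMn, eventually_ne_atTop 0] with n hn hn0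
  set s := {ω | 1 < tailSum M (X n ω)} with hs
  have hsm : MeasurableSet s := measurableSet_lt measurable_const (measurable_tailSum M (hXm n))
  have hle : ∀ ω, (esd ((1 / √(n : ℝ)) • X n ω) : Measure ℝ) {x | r < ‖x‖}
      ≤ ENNReal.ofReal ((M ^ 2 + 1) / r ^ 2) + s.indicator 1 ω := fun ω => by
    by_cases hω : ω ∈ s
    · rw [Set.indicator_of_mem hω]
      exact prob_le_one.trans le_add_self
    · rw [Set.indicator_of_notMem hω, add_zero]
      refine measure_norm_gt_le _ hr0 ((lintegral_sq_esd_le hn0 M _).trans ?_)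
      refine ENNReal.ofReal_le_ofReal ?_
      have : tailSum M (X n ω) ≤ 1 := not_lt.1 hω
      linarith
  rw [hEL n _ (measurableSet_lt measurable_const (by fun_prop))]
  calc _ ≤ ∫⁻ ω, (ENNReal.ofReal ((M ^ 2 + 1) / r ^ 2) + s.indicator 1 ω) ∂P := lintegral_mono hle
    _ = ENNReal.ofReal ((M ^ 2 + 1) / r ^ 2) + P s := by
      rw [lintegral_add_left measurable_const, lintegral_indicator_one hsm]
      simp
    _ ≤ ε / 2 + ε / 2 := add_le_add hr hn.le
    _ = ε := ENNReal.add_halves ε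

theorem concentratesAroundMean_of_lindeberg [IsProbabilityMeasure P] {d : ℕ}
    {I : LinkFamily d} {Z : (Fin d → ℤ) → Ω → ℂ} {X : (n : ℕ) → Ω → HermMat n}
    (hZ : ∀ z, Measurable (Z z)) (hind : iIndepFun Z P) (hX : IsPatterned I Z X)
    (hL : LindebergCondition P X) (hI : I.SmallFibers) :
    ConcentratesAroundMean P fun (n : ℕ) ω => esd ((1 / √(n : ℝ)) • X n ω) := by
  have hXm := hX.measurable_apply hZ
  have hLm : ∀ n : ℕ, Measurable fun ω => (esd ((1 / √(n : ℝ)) • X n ω) : Measure ℝ) := fun n =>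
    measurable_coe_esd (measurable_smul_hermMat_apply (hXm n) (1 / √(n : ℝ)))
  choose EL hEL using fun n => exists_isMeanMeasure P (hLm n)
  refine ⟨EL, hEL, fun dm hdm => ?_⟩
  have hmom : ∀ n k, ∫ x, cayley x ^ k ∂(EL n : Measure ℝ)
      = ∫ ω, cayleyMoment k (X n ω) ∂P := fun n k =>
    (hEL n).integral_eq (hLm n) (continuous_cayley.measurable.pow_const k) (b := 1)
      fun x => by simp [norm_cayley]
  rw [tendstoInMeasure_iff_norm]
  intro ε hε
  rw [ENNReal.tendsto_nhds_zero]
  intro δ hδ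
  obtain ⟨M, -, hMn⟩ := hL.exists_eventually_lt one_pos (ENNReal.half_pos hδ.ne')
  -- One tight set must contain both the means and the random measures; the latter lie in it only
  -- off the event that the tail sum exceeds 1.
  have htight := (isTightMeasureSet_range_mean hXm hL hEL).union
    (isTightMeasureSet_lintegral_sq_le (M ^ 2 + 1))
  obtain ⟨K, θ, hθ, hclose⟩ := exists_dist_lt_of_cayley_close dm hdm htight hε
  have hsum : Tendsto (fun n => ∑ k ∈ Finset.range K, ENNReal.ofReal (θ⁻¹ *
      ∫ ω, ‖cayleyMoment k (X n ω) - ∫ ω', cayleyMoment k (X n ω') ∂P‖ ∂P)) atTop (𝓝 0) := by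
    have h0 : (0 : ℝ≥0∞) = ∑ k ∈ Finset.range K, ENNReal.ofReal (θ⁻¹ * 0) := by simp
    rw [h0]
    exact tendsto_finsetSum _ fun k _ => ENNReal.tendsto_ofReal
      ((tendsto_integral_norm_cayleyMoment_sub hZ hind hX hL hI k).const_mul _)
  filter_upwards [hMn, (ENNReal.tendsto_nhds_zero.1 hsum) _ (ENNReal.half_pos hδ.ne'),
    eventually_ne_atTop 0] with n hn1 hn2 hn0
  set B : ℕ → Set Ω := fun k =>
    {ω | θ ≤ ‖cayleyMoment k (X n ω) - ∫ ω', cayleyMoment k (X n ω') ∂P‖} with hB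
  -- A large distance forces a large tail sum or a deviation in one of the K moments; Markov's
  -- inequality bounds the latter.
  have hsub : {ω | ε ≤ ‖dm.dist (esd ((1 / √(n : ℝ)) • X n ω)) (EL n) - 0‖}
      ⊆ {ω | 1 < tailSum M (X n ω)} ∪ ⋃ k ∈ Finset.range K, B k := by
    intro ω hω
    by_contra hcon
    rw [Set.mem_union, not_or, Set.mem_iUnion₂] at hcon
    obtain ⟨h1, h2⟩ := hcon
    push Not at h2
    have h3 := hclose (esd ((1 / √(n : ℝ)) • X n ω)) (EL n) (.inr ?_) (.inl ⟨n, rfl⟩) ?_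
    · rw [Set.mem_ofPred_eq, sub_zero, Real.norm_eq_abs,
        abs_of_nonneg (@dist_nonneg _ dm.toPseudoMetricSpace _ _)] at hω
      exact absurd h3 hω.not_gt
    · refine (lintegral_sq_esd_le hn0 M _).trans (ENNReal.ofReal_le_ofReal ?_)
      have : tailSum M (X n ω) ≤ 1 := not_lt.1 h1
      linarith
    · intro k hk
      rw [hmom]
      exact not_le.1 (h2 k (Finset.mem_range.2 hk))
  have hBk : ∀ k, P (B k) ≤ ENNReal.ofReal (θ⁻¹ *
      ∫ ω, ‖cayleyMoment k (X n ω) - ∫ ω', cayleyMoment k (X n ω') ∂P‖ ∂P) := fun k => by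
    have hi : Integrable (fun ω =>
        ‖cayleyMoment k (X n ω) - ∫ ω', cayleyMoment k (X n ω') ∂P‖) P :=
      ((integrable_of_measurable_of_bound (measurable_cayleyMoment k (hXm n)) 1 fun ω =>
        norm_cayleyMoment_le k _).sub (integrable_const _)).norm
    have h1 := mul_meas_ge_le_integral_of_nonneg (ae_of_all _ fun ω => norm_nonneg _) hi θ
    rw [← ENNReal.ofReal_toReal (measure_ne_top P (B k))]
    refine ENNReal.ofReal_le_ofReal ?_
    rw [← div_eq_inv_mul, le_div_iff₀ hθ, mul_comm]
    exact h1
  calc _ ≤ P ({ω | 1 < tailSum M (X n ω)} ∪ ⋃ k ∈ Finset.range K, B k) := measure_mono hsub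
    _ ≤ P {ω | 1 < tailSum M (X n ω)} + ∑ k ∈ Finset.range K, P (B k) :=
      (measure_union_le _ _).trans (by gcongr; exact measure_biUnion_finset_le _ _)
    _ ≤ δ / 2 + δ / 2 :=
      add_le_add hn1.le ((Finset.sum_le_sum fun k _ => hBk k).trans hn2)
    _ = δ := ENNReal.add_halves δ

end Concentration

/-! ### Fibres of the classical link functions. -/

section ClassicalLinks

/-- At most c positions per row give at most c n positions in a fibre, which is o(n²). -/
theorem LinkFamily.smallFibers_of_card_le {d : ℕ} {I : LinkFamily d} (c : ℕ)
    (h : ∀ (n : ℕ) (i : Fin n) (z : Fin d → ℤ), ∃ T : Finset ℤ, T.card ≤ c ∧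
      ∀ j : Fin n, I n i j = z → ((j : ℕ) : ℤ) ∈ T) : I.SmallFibers := by
  intro ε hε
  obtain ⟨N, hN⟩ := exists_nat_gt (c / ε)
  filter_upwards [eventually_ge_atTop N] with n hn z
  have hcard : (I.fiber n z).card ≤ n * c := by
    rw [LinkFamily.fiber, Finset.card_eq_sum_card_fiberwise (f := Prod.fst)
      (t := (Finset.univ : Finset (Fin n))) fun _ _ => by simp]
    calc _ ≤ ∑ _i : Fin n, c := Finset.sum_le_sum fun i _ => by
          obtain ⟨T, hT, hj⟩ := h n i z
          refine le_trans ?_ hT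
          refine Finset.card_le_card_of_injOn (fun p => ((p.2 : ℕ) : ℤ)) (fun p hp => ?_) ?_
          · obtain ⟨hp1, rfl⟩ := Finset.mem_filter.1 (Finset.mem_coe.1 hp)
            exact hj p.2 (Finset.mem_filter.1 hp1).2
          · intro p hp q hq hpq
            have hp1 := (Finset.mem_filter.1 (Finset.mem_coe.1 hp)).2
            have hq1 := (Finset.mem_filter.1 (Finset.mem_coe.1 hq)).2
            refine Prod.ext (hp1.trans hq1.symm) (Fin.ext ?_)
            simpa using hpq
      _ = n * c := by simp
  have hn' : (N : ℝ) ≤ n := by exact_mod_cast hn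
  rw [div_lt_iff₀ hε] at hN
  have hc : (c : ℝ) ≤ ε * n := by nlinarith
  calc ((I.fiber n z).card : ℝ) ≤ n * c := by exact_mod_cast hcard
    _ ≤ n * (ε * n) := by gcongr
    _ = ε * (n : ℝ) ^ 2 := by ring

theorem smallFibers_wignerLink : wignerLink.SmallFibers := by
  refine LinkFamily.smallFibers_of_card_le 2 fun n i z => ⟨{z 0 - 1, z 1 - 1},
    Finset.card_le_two, ?_⟩
  rintro j rfl
  rcases le_total i j with h | h
  · simp [wignerLink, h]
  · simp [wignerLink, h]

theorem smallFibers_toeplitzLink : toeplitzLink.SmallFibers := by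
  refine LinkFamily.smallFibers_of_card_le 2 fun n i z => ⟨{(i : ℤ) - z 0, (i : ℤ) + z 0},
    Finset.card_le_two, ?_⟩
  rintro j rfl
  simp only [toeplitzLink, Matrix.cons_val_zero, Finset.mem_insert, Finset.mem_singleton]
  rcases abs_cases ((i : ℤ) - (j : ℤ)) with h | h <;> omega

theorem smallFibers_hankelLink : hankelLink.SmallFibers := by
  refine LinkFamily.smallFibers_of_card_le 1 fun n i z => ⟨{z 0 - i - 2}, by simp, ?_⟩
  rintro j rfl
  simp only [hankelLink, Matrix.cons_val_zero, Finset.mem_singleton]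
  omega

theorem smallFibers_reversedCirculantLink : reversedCirculantLink.SmallFibers := by
  -- The value fixes j modulo n, and 0 ≤ j < n; the 2 undoes the shift to indices starting at 1.
  refine LinkFamily.smallFibers_of_card_le 1 fun n i z => ⟨{(z 0 - i - 2) % n}, by simp, ?_⟩
  rintro j rfl
  simp only [reversedCirculantLink, Matrix.cons_val_zero, Finset.mem_singleton]
  have h : ((((i : ℤ) + 1) + ((j : ℤ) + 1)) % (n : ℤ) - i - 2) % (n : ℤ) = (j : ℤ) % n := by
    refine Int.ModEq.eq ?_
    have h1 : (((i : ℤ) + 1) + ((j : ℤ) + 1)) % (n : ℤ) - i - 2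
        ≡ (((i : ℤ) + 1) + ((j : ℤ) + 1)) - i - 2 [ZMOD n] :=
      ((Int.mod_modEq _ _).sub_right _).sub_right _
    rwa [show ((i : ℤ) + 1) + ((j : ℤ) + 1) - i - 2 = j by ring] at h1
  rw [h, Int.emod_eq_of_lt (by omega) (by omega)]

theorem smallFibers_symmetricCirculantLink : symmetricCirculantLink.SmallFibers := by
  -- |i - j| is either z or n - z, with two signs each.
  refine LinkFamily.smallFibers_of_card_le 4 fun n i z =>
    ⟨{(i : ℤ) - z 0, (i : ℤ) + z 0, (i : ℤ) - (n - z 0), (i : ℤ) + (n - z 0)},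
      Finset.card_le_four, ?_⟩
  rintro j rfl
  simp only [symmetricCirculantLink, Matrix.cons_val_zero, Finset.mem_insert,
    Finset.mem_singleton]
  rcases abs_cases ((i : ℤ) - (j : ℤ)) with h | h <;>
    rcases min_cases |(i : ℤ) - (j : ℤ)| ((n : ℤ) - |(i : ℤ) - (j : ℤ)|) with h' | h' <;> omega

theorem IsClassicalLink.smallFibers {d : ℕ} {I : LinkFamily d} (h : IsClassicalLink I) :
    I.SmallFibers := by
  cases h with
  | wigner => exact smallFibers_wignerLink
  | toeplitz => exact smallFibers_toeplitzLink
  | hankel => exact smallFibers_hankelLink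
  | reversedCirculant => exact smallFibers_reversedCirculantLink
  | symmetricCirculant => exact smallFibers_symmetricCirculantLink

end ClassicalLinks

/-! ### Condition L from uniform integrability. -/

section UniformIntegrability

variable {Ω : Type*} [MeasurableSpace Ω] {P : Measure Ω}

theorem ofReal_tailSum {n : ℕ} (M : ℝ) (A : HermMat n) :
    ENNReal.ofReal (tailSum M A) = ENNReal.ofReal (1 / (n : ℝ) ^ 2)
      * ∑ i, ∑ j, (if M < ‖A.1 i j‖ then ENNReal.ofReal (‖A.1 i j‖ ^ 2) else 0) := by
  classical
  have h : ∀ i j, 0 ≤ (if M < ‖A.1 i j‖ then ‖A.1 i j‖ ^ 2 else 0) := fun i j => by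
    split_ifs <;> positivity
  rw [tailSum, ENNReal.ofReal_mul (by positivity)]
  congr 1
  rw [ENNReal.ofReal_sum_of_nonneg fun i _ => Finset.sum_nonneg fun j _ => by
    split_ifs <;> positivity]
  refine Finset.sum_congr rfl fun i _ => ?_
  rw [ENNReal.ofReal_sum_of_nonneg fun j _ => by split_ifs <;> positivity]
  refine Finset.sum_congr rfl fun j _ => ?_
  split_ifs <;> simp

theorem lintegral_sq_tail_le {Y : Ω → ℂ} {C : NNReal} {ε : ℝ} (hε : 0 ≤ ε)
    (h : eLpNorm ({ω | C ≤ ‖Y ω‖₊}.indicator Y) 2 P ≤ ENNReal.ofReal ε) {M : ℝ} (hM : (C : ℝ) ≤ M) :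
    ∫⁻ ω, (if M < ‖Y ω‖ then ENNReal.ofReal (‖Y ω‖ ^ 2) else 0) ∂P ≤ ENNReal.ofReal (ε ^ 2) := by
  have h1 := eLpNorm_nnreal_pow_eq_lintegral (p := 2) (μ := P)
    (f := {ω | C ≤ ‖Y ω‖₊}.indicator Y) (by norm_num)
  simp only [NNReal.coe_ofNat, ENNReal.rpow_ofNat, ENNReal.coe_ofNat] at h1
  rw [ENNReal.ofReal_pow hε]
  refine le_trans ?_ (pow_le_pow_left' h 2)
  rw [h1]
  refine lintegral_mono fun ω => ?_
  split_ifs with hω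
  · have hmem : ω ∈ {ω | C ≤ ‖Y ω‖₊} := by
      have : (C : ℝ) ≤ ‖Y ω‖ := hM.trans hω.le
      exact_mod_cast this
    rw [Set.indicator_of_mem hmem, ENNReal.ofReal_pow (norm_nonneg _), ofReal_norm]
  · exact zero_le

/-- The tail sum averages n² terms whose expectations are uniformly small for large M, so its own
expectation is small for every n ≠ 0 and Markov's inequality applies. -/
theorem lindebergCondition_of_uniformIntegrable {d : ℕ} {I : LinkFamily d}
    {Z : (Fin d → ℤ) → Ω → ℂ} {X : (n : ℕ) → Ω → HermMat n} (hZ : ∀ z, Measurable (Z z))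
    (hui : UniformIntegrable Z 2 P) (hX : IsPatterned I Z X) : LindebergCondition P X := by
  intro ε hε
  change Tendsto (fun M : ℝ => limsup (fun n : ℕ => P {ω | ε < tailSum M (X n ω)}) atTop)
    atTop (𝓝 0)
  rw [ENNReal.tendsto_nhds_zero]
  intro δ hδ
  -- θ bounds the L² tails; θ²/ε is the resulting Markov bound on the probability.
  obtain ⟨θ, hθ, hθδ⟩ : ∃ θ : ℝ, 0 < θ ∧ ENNReal.ofReal (θ ^ 2) / ENNReal.ofReal ε ≤ δ := by
    have hlim : Tendsto (fun t : ℝ => ENNReal.ofReal (t ^ 2 / ε)) (𝓝[>] 0) (𝓝 0) := by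
      have hc : Continuous fun t : ℝ => ENNReal.ofReal (t ^ 2 / ε) :=
        ENNReal.continuous_ofReal.comp (by fun_prop)
      have h0 := hc.tendsto 0
      simp only [ne_eq, OfNat.ofNat_ne_zero, not_false_eq_true, zero_pow, zero_div,
        ENNReal.ofReal_zero] at h0
      exact h0.mono_left nhdsWithin_le_nhds
    obtain ⟨t, ht1, ht2⟩ := ((ENNReal.tendsto_nhds_zero.1 hlim δ hδ).and
      self_mem_nhdsWithin).exists
    refine ⟨t, ht2, ?_⟩
    rwa [← ENNReal.ofReal_div_of_pos hε]
  obtain ⟨C, hC⟩ := hui.spec (by norm_num) (by norm_num) hθ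
  filter_upwards [eventually_ge_atTop (C : ℝ)] with M hM
  refine limsup_le_of_le (by isBoundedDefault) ?_
  filter_upwards [eventually_ne_atTop 0] with n hn
  have hXm := hX.measurable_apply hZ n
  have hentry : ∀ i j, ∫⁻ ω, (if M < ‖(X n ω).1 i j‖ then ENNReal.ofReal (‖(X n ω).1 i j‖ ^ 2)
      else 0) ∂P ≤ ENNReal.ofReal (θ ^ 2) := fun i j => by
    simp_rw [hX.norm_apply]
    exact lintegral_sq_tail_le hθ.le (hC _) hM
  have hmeas : ∀ i j, Measurable fun ω => (if M < ‖(X n ω).1 i j‖ then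
      ENNReal.ofReal (‖(X n ω).1 i j‖ ^ 2) else 0 : ℝ≥0∞) := fun i j => by
    have := hXm i j
    exact Measurable.ite (measurableSet_lt (by fun_prop) (by fun_prop)) (by fun_prop)
      measurable_const
  have hint : ∫⁻ ω, ENNReal.ofReal (tailSum M (X n ω)) ∂P ≤ ENNReal.ofReal (θ ^ 2) := by
    simp_rw [ofReal_tailSum]
    rw [lintegral_const_mul _ (Finset.measurable_sum _ fun i _ => Finset.measurable_sum _
      fun j _ => hmeas i j), lintegral_finsetSum _ fun i _ => Finset.measurable_sum _
      fun j _ => hmeas i j]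
    calc _ ≤ ENNReal.ofReal (1 / (n : ℝ) ^ 2) * ∑ _i : Fin n, ∑ _j : Fin n,
          ENNReal.ofReal (θ ^ 2) := by
          gcongr with i _
          rw [lintegral_finsetSum _ fun j _ => hmeas i j]
          exact Finset.sum_le_sum fun j _ => hentry i j
      _ = ENNReal.ofReal (θ ^ 2) := by
          have hn0 : (n : ℝ) ≠ 0 := by exact_mod_cast hn
          simp only [Finset.sum_const, Finset.card_univ, Fintype.card_fin, nsmul_eq_mul]
          rw [← ENNReal.ofReal_natCast, ← ENNReal.ofReal_mul (by positivity),
            ← ENNReal.ofReal_mul (by positivity), ← ENNReal.ofReal_mul (by positivity)]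
          congr 1
          field_simp
  have hsub : {ω | ε < tailSum M (X n ω)}
      ⊆ {ω | ENNReal.ofReal ε ≤ ENNReal.ofReal (tailSum M (X n ω))} := fun ω hω =>
    ENNReal.ofReal_le_ofReal (le_of_lt hω)
  refine (measure_mono hsub).trans (le_trans ?_ hθδ)
  rw [ENNReal.le_div_iff_mul_le (by simp [hε]) (by simp), mul_comm]
  exact (mul_meas_ge_le_lintegral (measurable_tailSum M hXm).ennreal_ofReal _).trans hint

end UniformIntegrability

theorem mainTheorem6 {Ω : Type*} [MeasurableSpace Ω] (P : Measure Ω) [IsProbabilityMeasure P] :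
    (∀ (d : ℕ) (I : LinkFamily d) (Z : (Fin d → ℤ) → Ω → ℂ) (X : (n : ℕ) → Ω → HermMat n),
      (∀ z, Measurable (Z z)) → iIndepFun Z P → IsPatterned I Z X →
      LindebergCondition P X → I.SmallFibers →
      ConcentratesAroundMean P (fun n ω => esd ((1 / Real.sqrt (n : ℝ)) • X n ω))) ∧
    (∀ (d : ℕ) (I : LinkFamily d), IsClassicalLink I →
      I.SmallFibers ∧
      ∀ (Z : (Fin d → ℤ) → Ω → ℂ) (X : (n : ℕ) → Ω → HermMat n),
        (∀ z, Measurable (Z z)) → UniformIntegrable Z 2 P → IsPatterned I Z X →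
        LindebergCondition P X) := by
  exact ⟨fun _ _ _ _ hZ hind hX hL hI => concentratesAroundMean_of_lindeberg hZ hind hX hL hI,
    fun _ _ hI => ⟨hI.smallFibers, fun _ _ hZ hui hX =>
      lindebergCondition_of_uniformIntegrable hZ hui hX⟩⟩
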